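/- **Theorem 1 (the Normex approximation).** Let $0<\alpha\le 4$ and $k=k(\alpha)=[4/\alpha-1]+1$ ($[\cdot]$ the integer part). For each $n$ let $X_1,\dots,X_n$ be iid Pareto random variables, $\mathbb P(X_i>x)=x^{-\alpha}$ for $x\ge1$, with order statistics $X_{(1)}\le\cdots\le X_{(n)}$ and sum $S_n$. For $n>k$ write $$S_n=T_k+X_{(n-k+1)}+U_{n-k+1},\qquad T_k=\sum_{j=1}^{n-k}X_{(j)},\quad U_{n-k+1}=\sum_{j=n-k+2}^{n}X_{(j)} .$$ For $y>1$ let $$f_{(i)}(y)=\frac{n!}{(i-1)!\,(n-i)!}\,\alpha\,(1-y^{-\alpha})^{i-1}y^{-\alpha(n-i+1)-1},\qquad h_y(u)=\frac{\alpha y^{\alpha}}{u^{\alpha+1}}\mathbf 1_{(u\ge y)},$$ $$m_1(y)=\frac{n-k}{1-y^{-\alpha}}\times\begin{cases}\dfrac{1-y^{1-\alpha}}{1-1/\alpha}&\alpha\ne1\\[2mm] \ln y&\alpha=1\end{cases}$$ $$\sigma^2(y)=\begin{cases}(n-k)\,y\left(1-\dfrac{y\ln^2y}{(y-1)^2}\right)&\alpha=1\\[2mm]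 2(n-k)\dfrac{y^2}{y^2-1}\left(\ln y-2\,\dfrac{y-1}{y+1}\right)&\alpha=2\\[2mm] \dfrac{n-k}{1-y^{-\alpha}}\left(\dfrac{1-y^{2-\alpha}}{1-2/\alpha}-\dfrac{1}{(1-1/\alpha)^2}\,\dfrac{(1-y^{1-\alpha})^2}{1-y^{-\alpha}}\right)&\alpha\ne1,2\end{cases}$$ and, $\varphi$ being the standard normal density, $\varphi_{m,s^2}$ the density of $N(m,s^2)$ and $h_y^{(k-1)*}$ the $(k-1)$-fold convolution of $h_y$, let for $x\ge1$ $$G_{n,\alpha,k}(x)=\begin{cases}\displaystyle n\alpha\int_1^x\frac{1}{\sigma(y)}\,\frac{(1-y^{-\alpha})^{n-1}}{y^{1+\alpha}}\int_0^{x-y}\varphi\!\left(\frac{v-m_1(y)}{\sigma(y)}\right)dv\,dy& k=1\\[4mm] \displaystyle\int_1^x f_{(n-k+1)}(y)\int_0^{x-y}\big(\varphi_{m_1(y),\sigma^2(y)}*h_y^{(k-1)*}\big)(v)\,dv\,dy& k\ge2.\end{cases}$$ Then $G_{n,\alpha,k}$ approximates the cdf of $S_n$ in the following sense. 1. For every $n>k$: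 $X_{(n-k+1)}$ has density $f_{(n-k+1)}$ on $(1,\infty)$. For almost every $y>1$, given $X_{(n-k+1)}=y$, the sums $T_k$ and $U_{n-k+1}$ are independent, $T_k$ has mean $m_1(y)$ and variance $\sigma^2(y)>0$ (with finite second moment), and, if $k\ge2$, $U_{n-k+1}$ has density $h_y^{(k-1)*}$. 2. For every $n>k$ and $x\ge1$, $$\big|\mathbb P(S_n\le x)-G_{n,\alpha,k}(x)\big|\le 2\int_1^x f_{(n-k+1)}(y)\,\Delta_n(y)\,dy,$$ where $\Delta_n(y)=\sup_{t\in\mathbb R}\big|\mathbb P(T_k\le t\mid X_{(n-k+1)}=y)-\Phi_{m_1(y),\sigma^2(y)}(t)\big|$ and $\Phi_{m,s^2}$ is the cdf of $N(m,s^2)$. 3. For almost every $y>1$, as $n\to\infty$, $\Delta_n(y)\to0$; and $\mathbb P(S_n\le x\mid X_{(n-k+1)}=y)$ minus the inner part of $G_{n,\alpha,k}(x)$ at $y$ (that is, $\frac1{\sigma(y)}\int_0^{x-y}\varphi\big(\frac{v-m_1(y)}{\sigma(y)}\big)dv$ if $k=1$, and $\int_0^{x-y}\big(\varphi_{m_1(y),\sigma^2(y)}*h_y^{(k-1)*}\big)(v)\,dv$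 if $k\ge2$) tends to $0$ uniformly in $x\ge y$. 4. If $\alpha\ge2$, then $\sup_{x\ge1}\big|\mathbb P(S_n\le x)-G_{n,\alpha,k}(x)\big|\to0$ as $n\to\infty$. -/

import Mathlib

open MeasureTheory ProbabilityTheory Filter Topology Set

noncomputable section

namespace Normex

/-- `orderStat x i` is the `i`-th smallest entry `x_{(i)}` of the sample `x`, for `1 ≤ i ≤ n`
(and `0` for other `i`). -/
def orderStat {n : ℕ} (x : Fin n → ℝ) (i : ℕ) : ℝ :=
  if h : 1 ≤ i ∧ i ≤ n then x (Tuple.sort x ⟨i - 1, by omega⟩) else 0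

/-- The trimmed sum `T_k = x_{(1)} + ⋯ + x_{(n-k)}`. -/
def trimmedSum {n : ℕ} (x : Fin n → ℝ) (k : ℕ) : ℝ :=
  ∑ j ∈ Finset.Icc 1 (n - k), orderStat x j

/-- The order statistic `x_{(n-k+1)}`, the `k`-th largest entry. -/
def pivot {n : ℕ} (x : Fin n → ℝ) (k : ℕ) : ℝ :=
  orderStat x (n - k + 1)

/-- The sum `U_{n-k+1} = x_{(n-k+2)} + ⋯ + x_{(n)}` of the `k - 1` largest entries. -/
def topSum {n : ℕ} (x : Fin n → ℝ) (k : ℕ) : ℝ :=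
  ∑ j ∈ Finset.Icc (n - k + 2) n, orderStat x j

/-- The threshold `k(α) = [4/α - 1] + 1` (used for `0 < α ≤ 4`). -/
def threshold (α : ℝ) : ℕ := ⌊4 / α - 1⌋₊ + 1

/-- The density of the `i`-th order statistic of an `n`-sample of the Pareto law with shape
`α` on `[1, ∞)`, at `x ≥ 1`. -/
def orderStatPDF (n i : ℕ) (α x : ℝ) : ℝ :=
  (n.factorial : ℝ) / (((i - 1).factorial : ℝ) * ((n - i).factorial : ℝ)) *
    α * (1 - x ^ (-α)) ^ (i - 1) * x ^ (-α * ((n : ℝ) - i + 1) - 1)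

/-- The mean `m₁(α, n, k, y)`. -/
def condMean (n k : ℕ) (α y : ℝ) : ℝ :=
  ((n : ℝ) - k) / (1 - y ^ (-α)) *
    (if α = 1 then Real.log y else (1 - y ^ (1 - α)) / (1 - 1 / α))

/-- The variance `σ²(α, n, k, y)`. -/
def condVar (n k : ℕ) (α y : ℝ) : ℝ :=
  if α = 1 then
    ((n : ℝ) - k) * y * (1 - y * Real.log y ^ 2 / (y - 1) ^ 2)
  else if α = 2 then
    2 * ((n : ℝ) - k) * (y ^ 2 / (y ^ 2 - 1)) * (Real.log y - 2 * ((y - 1) / (y + 1)))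
  else
    ((n : ℝ) - k) / (1 - y ^ (-α)) *
      ((1 - y ^ (2 - α)) / (1 - 2 / α) -
        1 / (1 - 1 / α) ^ 2 * ((1 - y ^ (1 - α)) ^ 2 / (1 - y ^ (-α))))

/-- The standard deviation `σ(y)`. -/
def condStd (n k : ℕ) (α y : ℝ) : ℝ := √(condVar n k α y)

/-- The normal law `N(m₁(y), σ²(y))`. -/
def condNormal (n k : ℕ) (α y : ℝ) : Measure ℝ :=
  gaussianReal (condMean n k α y) (condVar n k α y).toNNReal

/-- The convolution `(f ∗ g)(v) = ∫ f(u) g(v - u) du` of real functions on the line. -/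
def conv (f g : ℝ → ℝ) : ℝ → ℝ :=
  convolution f g (ContinuousLinearMap.mul ℝ ℝ) volume

/-- The `m`-fold convolution `f ∗ ⋯ ∗ f`, for `m ≥ 1` (the value at `m = 0` is not used). -/
def convPow (f : ℝ → ℝ) : ℕ → ℝ → ℝ
  | 0 => 0
  | 1 => f
  | m + 2 => conv (convPow f (m + 1)) f

/-- The density `h_y(x) = α y^α / x^(α+1)` for `x ≥ y` (and `0` for `x < y`) of the Pareto law
with parameters `α` and `y`. -/
def upperPDF (α y : ℝ) : ℝ → ℝ := paretoPDFReal y α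

/-- The inner integral of the mixture, at `s = x - y`. -/
def normexInner (n k : ℕ) (α y s : ℝ) : ℝ :=
  if k = 1 then
    1 / condStd n k α y *
      ∫ v in (0 : ℝ)..s, gaussianPDFReal 0 1 ((v - condMean n k α y) / condStd n k α y)
  else
    ∫ v in (0 : ℝ)..s,
      conv (gaussianPDFReal (condMean n k α y) (condVar n k α y).toNNReal)
        (convPow (upperPDF α y) (k - 1)) v

/-- The Normex mixture `G_{n,α,k}(x)`. -/
def normexCDF (n k : ℕ) (α x : ℝ) : ℝ :=
  if k = 1 then
    n * α * ∫ y in (1 : ℝ)..x,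
      (1 - y ^ (-α)) ^ (n - 1) / y ^ (1 + α) * normexInner n k α y (x - y)
  else
    ∫ y in (1 : ℝ)..x, orderStatPDF n (n - k + 1) α y * normexInner n k α y (x - y)

/-- The uniform (Kolmogorov) distance between the cdfs of two laws on the line. -/
def kolmogorovDist (μ ν : Measure ℝ) : ℝ := ⨆ t : ℝ, |cdf μ t - cdf ν t|

end Normex

end

noncomputable section
namespace Normex

/-! ### Kolmogorov distance -/

/-! Write `n = m + 1 + r` and `k = r + 1`. Given that the pivot equals `y`, the sample splits into
`m` iid entries with the Pareto law conditioned to lie below `y` and, independently, `r` iid entries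
with the Pareto law conditioned to lie above `y`. The latter law is again Pareto, with threshold
`y`, so the top sum keeps its exact law and only the trimmed sum is replaced by a normal one. The
splitting is a symmetrization argument: exactly `m! r!` of the `n!` rearrangements of a sample
without ties put the pivot in position `m` with the smaller entries before it and the larger ones
after it, and Fubini separates the blocks of such an arrangement (`lintegral_orderStat`,
`lintegral_blockFun`). The outcome is the disintegration `map_orderStat`, from which all conditional
laws are read off.

For the error bound, convolving two laws with a common factor does not increase their Kolmogorov
distance. The inner integral of the mixture also discards the mass that the normal law puts on the
negative side, which costs the same distance once more (`abs_conv_real_Iic_sub_Ioc_le`). Integrating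
over the pivot gives `abs_cdf_sub_normexCDF_le`.

For the limits, the entries below `y` are bounded by `y`. A central limit theorem that is uniform
over bounded laws (`exists_kolmogorovDist_sumLaw_le`) makes the conditional distance small whenever
`y` is small compared to `√(m v(y))`, where `v(y)` is the variance of one entry below `y`. For fixed
`y` this holds as `m` grows. The cdf of the whole sum requires it for most pivots. If `α > 2`, `v`
has a positive limit and the pivot exceeds `δ √m` with probability of order at most `m^k m^(-αk/2)`,
which tends to zero. If `α = 2`, then `k = 2` and the two powers cancel; what helps is that `v(y)`
tends to infinity (`pivotNegligible_two`). Pivots in a bounded range have exponentially small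
probability, up to a power of `m`. These estimates are combined in
`tendsto_integral_kolmogorovDist`. -/

lemma bddAbove_kolmogorovDist (μ ν : Measure ℝ) :
    BddAbove (range fun t : ℝ => |cdf μ t - cdf ν t|) := by
  refine ⟨1, ?_⟩
  rintro _ ⟨t, rfl⟩
  have h1 := cdf_nonneg μ t
  have h2 := cdf_le_one μ t
  have h3 := cdf_nonneg ν t
  have h4 := cdf_le_one ν t
  exact abs_le.2 ⟨by linarith, by linarith⟩

lemma abs_cdf_sub_le (μ ν : Measure ℝ) (t : ℝ) :
    |cdf μ t - cdf ν t| ≤ kolmogorovDist μ ν :=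
  le_ciSup (bddAbove_kolmogorovDist μ ν) t

lemma kolmogorovDist_le {μ ν : Measure ℝ} {c : ℝ} (h : ∀ t, |cdf μ t - cdf ν t| ≤ c) :
    kolmogorovDist μ ν ≤ c := ciSup_le h

lemma kolmogorovDist_nonneg (μ ν : Measure ℝ) : 0 ≤ kolmogorovDist μ ν :=
  (abs_nonneg _).trans (abs_cdf_sub_le μ ν 0)

lemma kolmogorovDist_le_one (μ ν : Measure ℝ) : kolmogorovDist μ ν ≤ 1 := by
  refine kolmogorovDist_le fun t => ?_
  have h1 := cdf_nonneg μ t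
  have h2 := cdf_le_one μ t
  have h3 := cdf_nonneg ν t
  have h4 := cdf_le_one ν t
  exact abs_le.2 ⟨by linarith, by linarith⟩

/-- Kolmogorov distance is invariant under increasing affine maps. -/
lemma kolmogorovDist_map_affine {μ ν : Measure ℝ} [IsProbabilityMeasure μ]
    [IsProbabilityMeasure ν] {a : ℝ} (ha : 0 < a) (b : ℝ) :
    kolmogorovDist (μ.map fun x => a * x + b) (ν.map fun x => a * x + b) =
      kolmogorovDist μ ν := by
  have hm : Measurable fun x : ℝ => a * x + b := by fun_prop
  have key : ∀ (ρ : Measure ℝ) [IsProbabilityMeasure ρ] (t : ℝ),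
      cdf (ρ.map fun x => a * x + b) t = cdf ρ ((t - b) / a) := by
    intro ρ _ t
    have := Measure.isProbabilityMeasure_map (μ := ρ) hm.aemeasurable
    rw [cdf_eq_real, cdf_eq_real, map_measureReal_apply hm measurableSet_Iic]
    congr 1
    ext x
    simp only [mem_preimage, mem_Iic, le_div_iff₀ ha]
    constructor <;> intro h <;> linarith
  apply le_antisymm
  · refine kolmogorovDist_le fun t => ?_
    rw [key, key]
    exact abs_cdf_sub_le _ _ _
  · refine kolmogorovDist_le fun t => ?_
    have := abs_cdf_sub_le (μ.map fun x => a * x + b) (ν.map fun x => a * x + b) (a * t + b)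
    rwa [key, key, add_sub_cancel_right, mul_div_cancel_left₀ _ ha.ne'] at this

/-- A sequence of `[0, 1]`-valued monotone functions converging pointwise to a continuous cdf
converges uniformly. -/
lemma tendstoUniformly_of_monotone {F : ℕ → ℝ → ℝ} {G : ℝ → ℝ} (hF : ∀ n, Monotone (F n))
    (hF0 : ∀ n t, 0 ≤ F n t) (hF1 : ∀ n t, F n t ≤ 1) (hG : Monotone G) (hGc : Continuous G)
    (hG0 : Tendsto G atBot (𝓝 0)) (hG1 : Tendsto G atTop (𝓝 1))
    (h : ∀ t, Tendsto (fun n => F n t) atTop (𝓝 (G t))) {ε : ℝ} (hε : 0 < ε) :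
    ∀ᶠ n in atTop, ∀ t, |F n t - G t| ≤ ε := by
  -- Pointwise convergence is used only at finitely many points `t i`, where `G` takes the levels `i
  -- / N`; monotonicity controls everything in between, at a cost of at most `3 / N`.
  obtain ⟨N, hN⟩ := exists_nat_gt (3 / ε)
  have hNpos : (0 : ℝ) < N := (by positivity : 0 < 3 / ε).trans hN
  have hNε : 3 / N < ε := by
    rw [div_lt_iff₀ hNpos]; rw [div_lt_iff₀ hε] at hN; linarith
  have hex : ∀ i : ℕ, ∃ t : ℝ, 0 < i → i < N → G t = i / N := by
    intro i
    by_cases hi : 0 < i ∧ i < N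
    · have h0 : (0 : ℝ) < i / N := div_pos (by exact_mod_cast hi.1) hNpos
      have h1 : (i : ℝ) / N < 1 := (div_lt_one hNpos).2 (by exact_mod_cast hi.2)
      obtain ⟨a, ha⟩ := (hG0.eventually (gt_mem_nhds h0)).exists
      obtain ⟨b, hb⟩ := (hG1.eventually (lt_mem_nhds h1)).exists
      obtain ⟨t, ht⟩ := mem_range_of_exists_le_of_exists_ge hGc ⟨a, ha.le⟩ ⟨b, hb.le⟩
      exact ⟨t, fun _ _ => ht⟩
    · exact ⟨0, fun h1 h2 => (hi ⟨h1, h2⟩).elim⟩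
  choose t ht using hex
  have hev : ∀ᶠ n in atTop, ∀ i ∈ Finset.range N, |F n (t i) - G (t i)| < 1 / N := by
    rw [Filter.eventually_all_finset]
    intro i _
    have := (h (t i)).eventually (Metric.ball_mem_nhds _ (by positivity : (0 : ℝ) < 1 / N))
    simpa [Real.dist_eq] using this
  have hGnn : ∀ x, 0 ≤ G x := fun x => ge_of_tendsto' (h x) (fun n => hF0 n x)
  filter_upwards [hev] with n hn x
  set j := ⌊N * G x⌋₊ with hj
  have hj1 : (j : ℝ) ≤ N * G x := Nat.floor_le (mul_nonneg hNpos.le (hGnn x))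
  have hj2 : N * G x < j + 1 := Nat.lt_floor_add_one _
  have hj1' : (j : ℝ) / N ≤ G x := by rw [div_le_iff₀ hNpos]; linarith
  have hj2' : G x < j / N + 1 / N := by rw [← add_div, lt_div_iff₀ hNpos]; linarith
  have e3 : (3 : ℝ) / N = 1 / N + 1 / N + 1 / N := by ring
  have hp : (0 : ℝ) < 1 / N := by positivity
  have up : F n x ≤ G x + 2 / N := by
    have e2 : (2 : ℝ) / N = 1 / N + 1 / N := by ring
    by_cases hjN : j + 1 < N
    · have hGt := ht (j + 1) (Nat.succ_pos _) hjN
      push_cast at hGt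
      rw [add_div] at hGt
      have hx : x ≤ t (j + 1) := by
        by_contra hcon
        have := hG (not_le.1 hcon).le
        linarith
      have h1 := hF n hx
      have h2 := abs_lt.1 (hn (j + 1) (Finset.mem_range.2 hjN))
      linarith [h2.2]
    · have : (N : ℝ) ≤ j + 1 := by exact_mod_cast not_lt.1 hjN
      have h3 : (1 : ℝ) ≤ j / N + 1 / N := by rw [← add_div, le_div_iff₀ hNpos]; linarith
      linarith [hF1 n x]
  -- The comparison point is `t (j - 1)` and not `t j`: `G` may be flat, so `t i ≤ x` only follows
  -- from the strict inequality `G (t i) < G x`. This accounts for the third `1 / N`.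
  have low : G x - 3 / N ≤ F n x := by
    by_cases hj' : 1 < j
    · obtain ⟨i, hi⟩ : ∃ i, j = i + 1 := ⟨j - 1, by omega⟩
      have hiN : i < N := by
        have hG1' : G x ≤ 1 := le_of_tendsto' (h x) (fun n => hF1 n x)
        have : (j : ℝ) ≤ N := hj1.trans (by nlinarith)
        have : j ≤ N := by exact_mod_cast this
        omega
      have hGt := ht i (by omega) hiN
      have hji : (j : ℝ) / N = i / N + 1 / N := by rw [hi]; push_cast; ring
      have hx : t i ≤ x := by
        by_contra hcon
        have := hG (not_le.1 hcon).le
        linarith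
      have h1 := hF n hx
      have h2 := abs_lt.1 (hn i (Finset.mem_range.2 hiN))
      linarith [h2.1]
    · have : (j : ℝ) ≤ 1 := by exact_mod_cast not_lt.1 hj'
      have h3 : (j : ℝ) / N ≤ 1 / N := by gcongr
      linarith [hF0 n x]
  rw [abs_le]
  have : (2 : ℝ) / N ≤ 3 / N := by gcongr; norm_num
  constructor <;> linarith

lemma continuous_cdf {μ : Measure ℝ} [IsProbabilityMeasure μ] [NullSingletonClass μ] :
    Continuous (cdf μ) := by
  refine continuous_iff_continuousAt.2 fun x => ?_
  have h := (cdf μ).measure_singleton x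
  rw [measure_cdf, measure_singleton, eq_comm, ENNReal.ofReal_eq_zero, sub_nonpos] at h
  rw [(monotone_cdf μ).continuousAt_iff_leftLim_eq_rightLim, (cdf μ).rightLim_eq]
  exact le_antisymm ((monotone_cdf μ).leftLim_le le_rfl) h

/-- Weak convergence to an atomless law implies convergence in Kolmogorov distance. -/
lemma tendsto_kolmogorovDist {μ : ℕ → Measure ℝ} {ν : Measure ℝ} [∀ n, IsProbabilityMeasure (μ n)]
    [IsProbabilityMeasure ν] [NullSingletonClass ν]
    (h : ∀ t, Tendsto (fun n => charFun (μ n) t) atTop (𝓝 (charFun ν t))) :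
    Tendsto (fun n => kolmogorovDist (μ n) ν) atTop (𝓝 0) := by
  let μ' : ℕ → ProbabilityMeasure ℝ := fun n => ⟨μ n, inferInstance⟩
  let ν' : ProbabilityMeasure ℝ := ⟨ν, inferInstance⟩
  have hw : Tendsto μ' atTop (𝓝 ν') := ProbabilityMeasure.tendsto_iff_tendsto_charFun.2 h
  have hp : ∀ t, Tendsto (fun n => cdf (μ n) t) atTop (𝓝 (cdf ν t)) := by
    intro t
    have := ProbabilityMeasure.tendsto_measure_of_null_frontier_of_tendsto' hw
      (E := Iic t) (by simp [ν'])
    simp only [cdf_eq_real]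
    exact (ENNReal.tendsto_toReal (measure_ne_top _ _)).comp this
  rw [Metric.tendsto_atTop']
  intro ε hε
  have := tendstoUniformly_of_monotone (fun n => monotone_cdf (μ n)) (fun n => cdf_nonneg _)
    (fun n => cdf_le_one _) (monotone_cdf ν) continuous_cdf (tendsto_cdf_atBot ν)
    (tendsto_cdf_atTop ν) hp (half_pos hε)
  obtain ⟨N, hN⟩ := eventually_atTop.1 this
  refine ⟨N, fun n hn => ?_⟩
  rw [Real.dist_eq, sub_zero, abs_of_nonneg (kolmogorovDist_nonneg _ _)]
  exact (kolmogorovDist_le (hN n hn.le)).trans_lt (half_lt_self hε)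

/-! ### A central limit theorem for triangular arrays of bounded variables -/

/-- By telescoping. It reduces the comparison of characteristic functions of sums to that of a
single summand. -/
lemma norm_pow_sub_pow_le_mul {a b : ℂ} (ha : ‖a‖ ≤ 1) (hb : ‖b‖ ≤ 1) (N : ℕ) :
    ‖a ^ N - b ^ N‖ ≤ N * ‖a - b‖ := by
  induction N with
  | zero => simp
  | succ N ih =>
    have : a ^ (N + 1) - b ^ (N + 1) = a ^ N * (a - b) + (a ^ N - b ^ N) * b := by ring
    rw [this]
    refine (norm_add_le _ _).trans ?_
    rw [norm_mul, norm_mul, norm_pow]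
    have h1 : ‖a‖ ^ N * ‖a - b‖ ≤ 1 * ‖a - b‖ := by
      gcongr
      exact pow_le_one₀ (norm_nonneg _) ha
    have h2 : ‖a ^ N - b ^ N‖ * ‖b‖ ≤ (N * ‖a - b‖) * 1 := by gcongr
    push_cast
    linarith

/-- Integrate the second-order Taylor expansion of the exponential. The remainder is at most `|s x|
^ 3 ≤ B |s| ^ 3 x ^ 2`, and the second moment is one; `hs` keeps `|s x| ≤ 1`, where the Taylor bound
applies. -/
lemma norm_charFun_sub_le {ν : Measure ℝ} [IsProbabilityMeasure ν] {B s : ℝ}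
    (hB : ∀ᵐ x ∂ν, |x| ≤ B) (h1 : ∫ x, x ∂ν = 0) (h2 : ∫ x, x ^ 2 ∂ν = 1) (hs : B * |s| ≤ 1) :
    ‖charFun ν s - (1 - (s : ℂ) ^ 2 / 2)‖ ≤ B * |s| ^ 3 := by
  have hid : Integrable (fun x : ℝ => x) ν :=
    Integrable.of_bound (by fun_prop) B (by simpa using hB)
  have hsq : Integrable (fun x : ℝ => x ^ 2) ν :=
    Integrable.of_bound (by fun_prop) (B ^ 2) (by
      filter_upwards [hB] with x hx
      rw [norm_pow]
      exact pow_le_pow_left₀ (norm_nonneg _) hx 2)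
  have hexp : Integrable (fun x : ℝ => Complex.exp (s * x * Complex.I)) ν :=
    Integrable.of_bound (by fun_prop) 1 (by
      filter_upwards with x
      rw [← Complex.ofReal_mul, Complex.norm_exp_ofReal_mul_I])
  have hidC : Integrable (fun x : ℝ => (x : ℂ)) ν := hid.ofReal
  have hsqC : Integrable (fun x : ℝ => (x : ℂ) ^ 2) ν := by
    simpa using hsq.ofReal (𝕜 := ℂ)
  have e : charFun ν s - (1 - (s : ℂ) ^ 2 / 2) =
      ∫ x, (Complex.exp (s * x * Complex.I) - (1 + (s * Complex.I) * x - (s : ℂ) ^ 2 / 2 * (x : ℂ) ^ 2)) ∂ν := by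
    have h1C : ∫ x : ℝ, (x : ℂ) ∂ν = 0 := by
      have := integral_ofReal (𝕜 := ℂ) (μ := ν) (f := fun x : ℝ => x)
      simpa [h1] using this
    have hi1 : Integrable (fun x : ℝ => (1 : ℂ) + (s * Complex.I) * x) ν :=
      (integrable_const _).add (hidC.const_mul _)
    have hi2 : Integrable (fun x : ℝ => (1 : ℂ) + (s * Complex.I) * x - (s : ℂ) ^ 2 / 2 * (x : ℂ) ^ 2)
        ν := hi1.sub (hsqC.const_mul _)
    rw [integral_sub hexp hi2,
      integral_sub hi1 (hsqC.const_mul _),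
      integral_add (integrable_const _) (hidC.const_mul _), integral_const_mul,
      integral_const_mul, h1C]
    have : ∫ x : ℝ, (x : ℂ) ^ 2 ∂ν = 1 := by
      have := integral_ofReal (𝕜 := ℂ) (μ := ν) (f := fun x : ℝ => x ^ 2)
      simpa [h2] using this
    rw [this, charFun_apply_real]
    simp
  rw [e]
  have hle : ∀ᵐ x : ℝ ∂ν, ‖Complex.exp (s * x * Complex.I) -
      (1 + (s * Complex.I) * x - (s : ℂ) ^ 2 / 2 * (x : ℂ) ^ 2)‖ ≤ B * |s| ^ 3 * x ^ 2 := by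
    filter_upwards [hB] with x hx
    have hn : ‖(s * x * Complex.I : ℂ)‖ = |s| * |x| := by simp
    have hn1 : ‖(s * x * Complex.I : ℂ)‖ ≤ 1 := by
      rw [hn, mul_comm]
      exact (mul_le_mul_of_nonneg_right hx (abs_nonneg _)).trans hs
    have := Complex.exp_bound hn1 (n := 3) (by norm_num)
    have e2 : ∑ m ∈ Finset.range 3, (s * x * Complex.I : ℂ) ^ m / (m.factorial : ℂ) =
        1 + (s * Complex.I) * x - (s : ℂ) ^ 2 / 2 * (x : ℂ) ^ 2 := by
      simp only [Finset.sum_range_succ, Finset.sum_range_zero, Nat.factorial]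
      push_cast
      have := Complex.I_sq
      linear_combination (s : ℂ) ^ 2 * (x : ℂ) ^ 2 / 2 * this
    rw [e2, hn] at this
    refine this.trans ?_
    have h3 : ((Nat.succ 3 : ℕ) : ℝ) * (((3 : ℕ).factorial : ℝ) * (3 : ℕ))⁻¹ ≤ 1 := by
      norm_num [Nat.factorial]
    calc (|s| * |x|) ^ 3 * (((Nat.succ 3 : ℕ) : ℝ) * (((3 : ℕ).factorial : ℝ) * (3 : ℕ))⁻¹)
        ≤ (|s| * |x|) ^ 3 * 1 := by gcongr
      _ = |s| ^ 3 * |x| ^ 2 * |x| := by ring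
      _ ≤ |s| ^ 3 * |x| ^ 2 * B := by gcongr
      _ = B * |s| ^ 3 * x ^ 2 := by rw [sq_abs]; ring
  refine (norm_integral_le_of_norm_le (hsq.const_mul _) hle).trans ?_
  rw [integral_const_mul, h2, mul_one]

lemma tendsto_charFun_pow {ν : ℕ → Measure ℝ} [∀ n, IsProbabilityMeasure (ν n)] {B δ : ℕ → ℝ}
    {N : ℕ → ℕ} (hB : ∀ n, ∀ᵐ x ∂ν n, |x| ≤ B n) (h1 : ∀ n, ∫ x, x ∂ν n = 0)
    (h2 : ∀ n, ∫ x, x ^ 2 ∂ν n = 1) (hδ : Tendsto δ atTop (𝓝 0)) (hBδ : ∀ n, B n ≤ δ n * √(N n))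
    (t : ℝ) :
    Tendsto (fun n => charFun (ν n) ((√(N n))⁻¹ * t) ^ N n) atTop
      (𝓝 (Complex.exp (-(t : ℂ) ^ 2 / 2))) := by
  -- A unit second moment forces `B n ≥ 1`. With `hBδ` this gives `1 / √(N n) ≤ δ n`, so that `N n`
  -- is positive and tends to infinity without a separate hypothesis.
  have hB1 : ∀ n, 1 ≤ B n := by
    intro n
    have hB0 : 0 ≤ B n := by
      obtain ⟨x, hx⟩ := (hB n).exists
      exact (abs_nonneg _).trans hx
    have : ∫ x, x ^ 2 ∂ν n ≤ ∫ _, B n ^ 2 ∂ν n := by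
      refine integral_mono_of_nonneg (ae_of_all _ fun x => sq_nonneg x) (integrable_const _) ?_
      filter_upwards [hB n] with x hx
      exact sq_le_sq' (by linarith [abs_le.1 hx]) (abs_le.1 hx).2
    rw [h2] at this
    simp only [integral_const, probReal_univ, smul_eq_mul, one_mul] at this
    nlinarith
  have hN : ∀ n, (0 : ℝ) < √(N n) := by
    intro n
    by_contra hcon
    have h0 : √(N n : ℝ) = 0 := le_antisymm (not_lt.1 hcon) (Real.sqrt_nonneg _)
    have := hBδ n
    rw [h0, mul_zero] at this
    linarith [hB1 n]
  have hδ0 : ∀ n, B n * (√(N n))⁻¹ ≤ δ n := by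
    intro n
    rw [← div_eq_mul_inv, div_le_iff₀ (hN n)]
    exact hBδ n
  have hinv : ∀ n, (√(N n : ℝ))⁻¹ ≤ δ n := fun n =>
    (le_mul_of_one_le_left (inv_pos.2 (hN n)).le (hB1 n)).trans (hδ0 n)
  rw [tendsto_iff_norm_sub_tendsto_zero]
  have hbound : Tendsto (fun n => |t| ^ 3 * δ n + t ^ 4 * δ n ^ 2) atTop (𝓝 0) := by
    have := (hδ.const_mul (|t| ^ 3)).add ((hδ.pow 2).const_mul (t ^ 4))
    simpa using this
  have hsm : ∀ᶠ n in atTop, δ n * (|t| + 1) ≤ 1 := by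
    have h0 : Tendsto (fun n => δ n * (|t| + 1)) atTop (𝓝 0) := by
      simpa using hδ.mul_const (|t| + 1)
    exact (h0.eventually (gt_mem_nhds one_pos)).mono fun n hn => hn.le
  refine squeeze_zero' (Eventually.of_forall fun _ => norm_nonneg _) ?_ hbound
  filter_upwards [hsm] with n hn
  set s : ℝ := (√(N n : ℝ))⁻¹ * t with hs
  have hsq : √(N n : ℝ) ^ 2 = N n := Real.sq_sqrt (Nat.cast_nonneg _)
  have hN0 : (0 : ℝ) < N n := by rw [← hsq]; exact pow_pos (hN n) 2
  have hNs : (N n : ℝ) * s ^ 2 = t ^ 2 := by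
    rw [hs, mul_pow, inv_pow, hsq, ← mul_assoc, mul_inv_cancel₀ hN0.ne', one_mul]
  have habs : |s| = (√(N n : ℝ))⁻¹ * |t| := by
    rw [hs, abs_mul, abs_of_pos (inv_pos.2 (hN n))]
  have hδn : 0 ≤ δ n := (inv_pos.2 (hN n)).le.trans (hinv n)
  have hbs : B n * |s| ≤ 1 := by
    rw [habs, ← mul_assoc]
    calc B n * (√(N n : ℝ))⁻¹ * |t| ≤ δ n * (|t| + 1) := by
          gcongr
          · exact hδ0 n
          · linarith
      _ ≤ 1 := hn
  have hs1 : |s| ≤ 1 :=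
    (le_mul_of_one_le_left (abs_nonneg s) (hB1 n)).trans hbs
  have hss : s ^ 2 ≤ 1 := by rw [← sq_abs]; exact pow_le_one₀ (abs_nonneg _) hs1
  -- The Gaussian limit is itself an `N n`-th power, so both sides can be compared factor by factor
  -- at `s = t / √(N n)`.
  have hE : Complex.exp (-(t : ℂ) ^ 2 / 2) = Complex.exp (((-(s ^ 2 / 2) : ℝ) : ℂ)) ^ N n := by
    rw [← Complex.exp_nat_mul]
    congr 1
    rw [← Complex.ofReal_natCast, ← Complex.ofReal_mul]
    have : (N n : ℝ) * (-(s ^ 2 / 2)) = -t ^ 2 / 2 := by rw [← hNs]; ring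
    rw [this]; push_cast; ring
  have hnb : ‖Complex.exp (((-(s ^ 2 / 2) : ℝ) : ℂ))‖ ≤ 1 := by
    rw [Complex.norm_exp, Complex.ofReal_re]
    exact Real.exp_le_one_iff.2 (by nlinarith [sq_nonneg s])
  rw [hE]
  refine (norm_pow_sub_pow_le_mul (norm_charFun_le_one _) hnb _).trans ?_
  have hA := norm_charFun_sub_le (hB n) (h1 n) (h2 n) hbs
  have hexp : ‖(1 - (s : ℂ) ^ 2 / 2) - Complex.exp (((-(s ^ 2 / 2) : ℝ) : ℂ))‖ ≤ s ^ 4 := by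
    have h3 : ‖((-(s ^ 2 / 2) : ℝ) : ℂ)‖ = s ^ 2 / 2 := by
      rw [Complex.norm_real, norm_neg, Real.norm_of_nonneg (by positivity)]
    have h4 := Complex.norm_exp_sub_one_sub_id_le (x := ((-(s ^ 2 / 2) : ℝ) : ℂ))
      (by rw [h3]; linarith)
    rw [h3] at h4
    rw [norm_sub_rev]
    have : Complex.exp (((-(s ^ 2 / 2) : ℝ) : ℂ)) - (1 - (s : ℂ) ^ 2 / 2) =
      Complex.exp (((-(s ^ 2 / 2) : ℝ) : ℂ)) - 1 - ((-(s ^ 2 / 2) : ℝ) : ℂ) := by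
        push_cast; ring
    rw [this]
    refine h4.trans ?_
    nlinarith [sq_nonneg (s ^ 2)]
  have htri : ‖charFun (ν n) s - Complex.exp (((-(s ^ 2 / 2) : ℝ) : ℂ))‖ ≤ B n * |s| ^ 3 + s ^ 4 := by
    have := norm_add_le (charFun (ν n) s - (1 - (s : ℂ) ^ 2 / 2))
      ((1 - (s : ℂ) ^ 2 / 2) - Complex.exp (((-(s ^ 2 / 2) : ℝ) : ℂ)))
    rw [sub_add_sub_cancel] at this
    linarith
  calc (N n : ℝ) * ‖charFun (ν n) s - Complex.exp (((-(s ^ 2 / 2) : ℝ) : ℂ))‖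
      ≤ N n * (B n * |s| ^ 3 + s ^ 4) := by gcongr
    _ = (N n * s ^ 2) * (B n * |s| + s ^ 2) := by rw [← sq_abs s]; ring_nf; rw [show |s| ^ 4 = (|s| ^ 2) ^ 2 by ring, sq_abs]; ring
    _ = t ^ 2 * (B n * (√(N n : ℝ))⁻¹ * |t| + t ^ 2 * ((√(N n : ℝ))⁻¹) ^ 2) := by
        rw [hNs, habs, hs]; ring
    _ ≤ t ^ 2 * (δ n * |t| + t ^ 2 * δ n ^ 2) := by
        gcongr
        · exact hδ0 n
        · exact hinv n
    _ = |t| ^ 3 * δ n + t ^ 4 * δ n ^ 2 := by rw [← sq_abs t]; ring_nf; rw [show |t| ^ 4 = (|t| ^ 2) ^ 2 by ring, sq_abs]; ring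

/-- The law of the sum of `N` independent variables of law `ν`. -/
def sumLaw (N : ℕ) (ν : Measure ℝ) : Measure ℝ :=
  (Measure.pi fun _ : Fin N => ν).map fun x => ∑ i, x i

instance (N : ℕ) (ν : Measure ℝ) [IsProbabilityMeasure ν] : IsProbabilityMeasure (sumLaw N ν) :=
  Measure.isProbabilityMeasure_map (by fun_prop)

lemma charFun_sumLaw (N : ℕ) (ν : Measure ℝ) [IsProbabilityMeasure ν] (t : ℝ) :
    charFun (sumLaw N ν) t = charFun ν t ^ N := by
  rw [sumLaw, charFun_map_sum_pi_eq_prod]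
  simp

lemma sumLaw_map_affine (N : ℕ) (ν : Measure ℝ) [IsProbabilityMeasure ν] (a b : ℝ) :
    sumLaw N (ν.map fun x => a * x + b) = (sumLaw N ν).map fun x => a * x + N * b := by
  have : IsProbabilityMeasure (ν.map fun x => a * x + b) :=
    Measure.isProbabilityMeasure_map (by fun_prop)
  rw [sumLaw, ← Measure.pi_map_pi (fun _ => by fun_prop), sumLaw, Measure.map_map (by fun_prop)
    (by fun_prop), Measure.map_map (by fun_prop) (by fun_prop)]
  congr 1
  ext x
  simp [Finset.sum_add_distrib, Finset.mul_sum]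

lemma tendsto_kolmogorovDist_sumLaw {ν : ℕ → Measure ℝ} [∀ n, IsProbabilityMeasure (ν n)]
    {B δ : ℕ → ℝ} {N : ℕ → ℕ} (hB : ∀ n, ∀ᵐ x ∂ν n, |x| ≤ B n) (h1 : ∀ n, ∫ x, x ∂ν n = 0)
    (h2 : ∀ n, ∫ x, x ^ 2 ∂ν n = 1) (hδ : Tendsto δ atTop (𝓝 0))
    (hBδ : ∀ n, B n ≤ δ n * √(N n)) :
    Tendsto (fun n => kolmogorovDist ((sumLaw (N n) (ν n)).map fun x => (√(N n))⁻¹ * x)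
      (gaussianReal 0 1)) atTop (𝓝 0) := by
  have : ∀ n, IsProbabilityMeasure ((sumLaw (N n) (ν n)).map fun x => (√(N n))⁻¹ * x) :=
    fun n => Measure.isProbabilityMeasure_map (by fun_prop)
  have : NullSingletonClass (gaussianReal 0 1) := nullSingletonClass_gaussianReal one_ne_zero
  refine tendsto_kolmogorovDist fun t => ?_
  have := tendsto_charFun_pow hB h1 h2 hδ hBδ t
  simp only [charFun_map_mul, charFun_sumLaw]
  simpa [charFun_gaussianReal, neg_div] using this

/-- **Uniform central limit theorem** for bounded variables: the Kolmogorov distance between the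
law of a sum of `N` iid variables bounded by `B` after centering and the normal law with the same
mean and variance is small as soon as `B` is small compared to the standard deviation of the
sum. -/
theorem exists_kolmogorovDist_sumLaw_le {ε : ℝ} (hε : 0 < ε) :
    ∃ δ > 0, ∀ (N : ℕ) (ν : Measure ℝ) [IsProbabilityMeasure ν] (B m v : ℝ),
      (∀ᵐ x ∂ν, |x - m| ≤ B) → ∫ x, x ∂ν = m → ∫ x, (x - m) ^ 2 ∂ν = v → 0 < v →
      B ≤ δ * √(N * v) →
      kolmogorovDist (sumLaw N ν) (gaussianReal (N * m) (N * v).toNNReal) ≤ ε := by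
  -- If no `δ` works, counterexamples for `δ = 1 / (n + 1)` form a triangular array. Standardized,
  -- it satisfies the hypotheses of `tendsto_kolmogorovDist_sumLaw`, while its distances stay above
  -- `ε`. Compactness of this kind gives uniformity over all laws without a rate.
  by_contra! hcon
  choose N ν hν B m v hB h1 h2 hv hBδ hkd using fun n : ℕ =>
    hcon (1 / ((n : ℝ) + 1)) (by positivity)
  let ν' : ℕ → Measure ℝ := fun n => (ν n).map fun x => (√(v n))⁻¹ * x + -(√(v n))⁻¹ * m n
  have hsv : ∀ n, 0 < √(v n) := fun n => Real.sqrt_pos.2 (hv n)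
  have hm : ∀ n, Measurable fun x : ℝ => (√(v n))⁻¹ * x + -(√(v n))⁻¹ * m n := fun n => by fun_prop
  have : ∀ n, IsProbabilityMeasure (ν' n) := fun n =>
    Measure.isProbabilityMeasure_map (hm n).aemeasurable
  have hB' : ∀ n, ∀ᵐ x ∂ν' n, |x| ≤ B n / √(v n) := by
    intro n
    refine (ae_map_iff (hm n).aemeasurable (measurableSet_le (by fun_prop) (by fun_prop))).2 ?_
    filter_upwards [hB n] with x hx
    rw [show (√(v n))⁻¹ * x + -(√(v n))⁻¹ * m n = (x - m n) / √(v n) by ring, abs_div,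
      abs_of_pos (hsv n)]
    gcongr
  have hint : ∀ n, Integrable (fun x : ℝ => x) (ν n) := by
    intro n
    have : Integrable (fun x : ℝ => x - m n) (ν n) :=
      Integrable.of_bound (by fun_prop) (B n) (by simpa using hB n)
    refine (this.add (integrable_const (m n))).congr (ae_of_all _ fun x => ?_)
    simp
  have h1' : ∀ n, ∫ x, x ∂ν' n = 0 := by
    intro n
    rw [integral_map (hm n).aemeasurable (by fun_prop), integral_add ((hint n).const_mul _)
      (integrable_const _), integral_const_mul, h1]
    simp
  have h2' : ∀ n, ∫ x, x ^ 2 ∂ν' n = 1 := by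
    intro n
    rw [integral_map (hm n).aemeasurable (by fun_prop)]
    have : ∀ x, ((√(v n))⁻¹ * x + -(√(v n))⁻¹ * m n) ^ 2 = (v n)⁻¹ * (x - m n) ^ 2 := by
      intro x
      rw [show (√(v n))⁻¹ * x + -(√(v n))⁻¹ * m n = (√(v n))⁻¹ * (x - m n) by ring, mul_pow,
        inv_pow, Real.sq_sqrt (hv n).le]
    simp only [this, integral_const_mul, h2]
    exact inv_mul_cancel₀ (hv n).ne'
  have hlim := tendsto_kolmogorovDist_sumLaw hB' h1' h2'
    (tendsto_one_div_add_atTop_nhds_zero_nat (𝕜 := ℝ)) (N := N) (by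
      intro n
      rw [div_le_iff₀ (hsv n), mul_assoc, ← Real.sqrt_mul (Nat.cast_nonneg _)]
      exact hBδ n)
  obtain ⟨n, hn⟩ := (hlim.eventually (gt_mem_nhds hε)).exists
  -- With `N n = 0` the hypothesis on `B n` would make the law a point mass, against `v n > 0`.
  have hNpos : (0 : ℝ) < N n := by
    by_contra h0
    have h0 : (N n : ℝ) = 0 := le_antisymm (not_lt.1 h0) (Nat.cast_nonneg _)
    have hb := hBδ n
    rw [h0, zero_mul, Real.sqrt_zero, mul_zero] at hb
    have : ∫ x, (x - m n) ^ 2 ∂ν n = 0 := by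
      refine integral_eq_zero_of_ae ?_
      filter_upwards [hB n] with x hx
      have : |x - m n| = 0 := le_antisymm (hx.trans hb) (abs_nonneg _)
      simp [abs_eq_zero.1 this]
    rw [h2] at this
    exact (hv n).ne' this
  have hsN : 0 < √(N n : ℝ) := Real.sqrt_pos.2 hNpos
  -- Scaling by `a` and centering standardizes both the sum and the normal law, and leaves the
  -- Kolmogorov distance unchanged.
  set a := (√(N n : ℝ))⁻¹ * (√(v n))⁻¹ with ha
  have hapos : 0 < a := mul_pos (inv_pos.2 hsN) (inv_pos.2 (hsv n))
  have ha2 : a ^ 2 * (N n * v n) = 1 := by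
    rw [ha, mul_pow, inv_pow, inv_pow, Real.sq_sqrt hNpos.le, Real.sq_sqrt (hv n).le]
    field_simp [(hv n).ne']
  refine (hkd n).not_ge (le_of_lt ?_)
  rw [← kolmogorovDist_map_affine hapos (-(a * (N n * m n)))]
  convert hn using 2
  · rw [sumLaw_map_affine, Measure.map_map (by fun_prop) (by fun_prop)]
    congr 1
    ext x
    simp only [Function.comp, ha]
    ring
  · have : (fun x => a * x + -(a * (N n * m n))) = (fun x => x + -(a * (N n * m n))) ∘ fun x => a * x := rfl
    rw [this, ← Measure.map_map (by fun_prop) (by fun_prop), gaussianReal_map_const_mul,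
      gaussianReal_map_add_const]
    congr 1
    · ring
    · ext
      rw [NNReal.coe_mul, Real.coe_toNNReal _ (by have := hv n; positivity)]
      simpa using ha2

/-! ### Order statistics -/

lemma sum_orderStat {n : ℕ} (x : Fin n → ℝ) {a b : ℕ} (hb : b ≤ n) :
    ∑ i ∈ Finset.Icc (a + 1) b, orderStat x i =
      ∑ j : Fin n, if a ≤ (j : ℕ) ∧ (j : ℕ) < b then x (Tuple.sort x j) else 0 := by
  rw [← Finset.sum_filter]
  symm
  refine Finset.sum_bij (fun j _ => (j : ℕ) + 1) ?_ ?_ ?_ ?_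
  · intro j hj
    simp only [Finset.mem_filter, Finset.mem_univ, true_and] at hj
    simp only [Finset.mem_Icc]
    omega
  · intro i _ j _ hij
    exact Fin.ext (by omega)
  · intro i hi
    simp only [Finset.mem_Icc] at hi
    exact ⟨⟨i - 1, by omega⟩, by simp; omega, by simp; omega⟩
  · intro j _
    rw [orderStat, dif_pos ⟨by omega, by omega⟩]
    simp

lemma sum_eq_trimmedSum_add {n k : ℕ} (hk : 0 < k) (hkn : k < n) (x : Fin n → ℝ) :
    ∑ i, x i = trimmedSum x k + pivot x k + topSum x k := by
  have h := sum_orderStat x (a := 0) (le_refl n)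
  have e : ∑ i, x i = ∑ j ∈ Finset.Icc 1 n, orderStat x j := by
    rw [h, ← Equiv.sum_comp (Tuple.sort x)]
    refine Finset.sum_congr rfl fun j _ => ?_
    rw [if_pos ⟨Nat.zero_le _, j.2⟩]
  have e2 : ∀ a b : ℕ, Finset.Icc a b = Finset.Ico a (b + 1) := fun a b => by
    ext; simp
  have e3 := Finset.sum_Ico_consecutive (orderStat x) (show 1 ≤ n - k + 1 by omega)
    (show n - k + 1 ≤ n + 1 by omega)
  have e4 := Finset.sum_eq_sum_Ico_succ_bot (show n - k + 1 < n + 1 by omega) (orderStat x)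
  rw [e, trimmedSum, pivot, topSum, e2, e2, e2, ← e3, e4]
  ring

section Blocks

variable {m r : ℕ}

/-- The index of the pivot in a sample of size `m + 1 + r`. -/
def mid (m r : ℕ) : Fin (m + 1 + r) := ⟨m, by omega⟩

lemma pivot_eq (x : Fin (m + 1 + r) → ℝ) :
    pivot x (r + 1) = (x ∘ Tuple.sort x) (mid m r) := by
  have h : m + 1 + r - (r + 1) + 1 = m + 1 := by omega
  rw [pivot, h, orderStat, dif_pos ⟨by omega, by omega⟩]
  rfl

lemma trimmedSum_eq (x : Fin (m + 1 + r) → ℝ) :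
    trimmedSum x (r + 1) = ∑ j, if j < mid m r then (x ∘ Tuple.sort x) j else 0 := by
  have h : m + 1 + r - (r + 1) = m := by omega
  rw [trimmedSum, h, sum_orderStat x (a := 0) (by omega)]
  refine Finset.sum_congr rfl fun j _ => ?_
  simp [mid, Fin.lt_def]

lemma topSum_eq (x : Fin (m + 1 + r) → ℝ) :
    topSum x (r + 1) = ∑ j, if mid m r < j then (x ∘ Tuple.sort x) j else 0 := by
  have h : m + 1 + r - (r + 1) + 2 = (m + 1) + 1 := by omega
  rw [topSum, h, sum_orderStat x (a := m + 1) le_rfl]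
  refine Finset.sum_congr rfl fun j _ => ?_
  have : (m + 1 ≤ (j : ℕ) ∧ (j : ℕ) < m + 1 + r) ↔ mid m r < j := by
    simp only [mid, Fin.lt_def]
    omega
  simp only [this, Function.comp]

/-- The samples whose first `m` entries are below, and whose last `r` entries are above, the entry
in position `m`. -/
def blockSet (m r : ℕ) : Set (Fin (m + 1 + r) → ℝ) :=
  {x | (∀ j < mid m r, x j < x (mid m r)) ∧ ∀ j > mid m r, x (mid m r) < x j}

lemma measurableSet_blockSet : MeasurableSet (blockSet m r) := by
  have : blockSet m r = (⋂ j, ⋂ (_ : j < mid m r), {x | x j < x (mid m r)}) ∩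
      ⋂ j, ⋂ (_ : mid m r < j), {x | x (mid m r) < x j} := by
    ext x; simp [blockSet]
  rw [this]
  refine MeasurableSet.inter ?_ ?_ <;>
  exact MeasurableSet.iInter fun j => MeasurableSet.iInter fun _ =>
    measurableSet_lt (measurable_pi_apply _) (measurable_pi_apply _)

/-- The position of an index relative to the pivot. -/
def side (m r : ℕ) (j : Fin (m + 1 + r)) : Ordering := cmp j (mid m r)

/-- Since `z` is strictly increasing, the entries of `z ∘ τ` are ordered like the indices `τ j`.
Membership thus says that `τ` preserves the sides of the pivot, once it is known to fix `mid m r`.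
-/
lemma comp_perm_mem_blockSet_iff {z : Fin (m + 1 + r) → ℝ} (hz : StrictMono z)
    (τ : Equiv.Perm (Fin (m + 1 + r))) :
    z ∘ τ ∈ blockSet m r ↔ side m r ∘ τ = side m r := by
  have hside : ∀ i j : Fin (m + 1 + r), cmp i (mid m r) = cmp j (mid m r) ↔
      (i < mid m r ↔ j < mid m r) ∧ (mid m r < i ↔ mid m r < j) := by
    intro i j
    constructor
    · intro h
      have h1 := cmp_eq_lt_iff i (mid m r)
      have h2 := cmp_eq_gt_iff i (mid m r)
      rw [h] at h1 h2
      rw [← h1, ← h2, cmp_eq_lt_iff, cmp_eq_gt_iff]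
      exact ⟨Iff.rfl, Iff.rfl⟩
    · rintro ⟨h1, h2⟩
      rcases lt_trichotomy j (mid m r) with h | h | h
      · rw [(cmp_eq_lt_iff _ _).2 h, (cmp_eq_lt_iff _ _).2 (h1.2 h)]
      · subst h
        have hi : i = mid m r :=
          le_antisymm (not_lt.1 fun hc => lt_irrefl _ (h2.1 hc))
            (not_lt.1 fun hc => lt_irrefl _ (h1.1 hc))
        rw [hi]
      · rw [(cmp_eq_gt_iff _ _).2 h, (cmp_eq_gt_iff _ _).2 (h2.2 h)]
  constructor
  · rintro ⟨h1, h2⟩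
    simp only [Function.comp, hz.lt_iff_lt] at h1 h2
    have h3 : ∀ j, τ j < τ (mid m r) ↔ j < mid m r := by
      intro j
      refine ⟨fun h => ?_, h1 j⟩
      by_contra hc
      rcases (not_lt.1 hc).lt_or_eq with h' | h'
      · exact lt_asymm h (h2 j h')
      · rw [h'] at h; exact lt_irrefl _ h
    -- `τ` maps the indices below `mid m r` onto those below its image, and an index of `Fin` is the
    -- number of indices below it.
    have hfix : τ (mid m r) = mid m r := by
      have hc : (Finset.Iio (mid m r)).map τ.toEmbedding = Finset.Iio (τ (mid m r)) := by
        ext i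
        simp only [Finset.mem_map_equiv, Finset.mem_Iio]
        rw [← h3, Equiv.apply_symm_apply]
      have := congrArg Finset.card hc
      rw [Finset.card_map, Fin.card_Iio, Fin.card_Iio] at this
      exact (Fin.ext this).symm
    have h4 : ∀ j, τ (mid m r) < τ j ↔ mid m r < j := by
      intro j
      refine ⟨fun h => ?_, h2 j⟩
      by_contra hc
      rcases (not_lt.1 hc).lt_or_eq with h' | h'
      · exact lt_asymm h (h1 j h')
      · rw [h'] at h; exact lt_irrefl _ h
    ext1 j
    simp only [Function.comp, side]
    rw [hside]
    rw [hfix] at h3 h4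
    exact ⟨h3 j, h4 j⟩
  · intro h
    have h' : ∀ j, (τ j < mid m r ↔ j < mid m r) ∧ (mid m r < τ j ↔ mid m r < j) :=
      fun j => (hside _ _).1 (congrFun h j)
    have hfix : τ (mid m r) = mid m r :=
      le_antisymm (not_lt.1 fun hc => lt_irrefl _ ((h' _).2.1 hc))
        (not_lt.1 fun hc => lt_irrefl _ ((h' _).1.1 hc))
    refine ⟨fun j hj => ?_, fun j hj => ?_⟩
    · simp only [Function.comp, hz.lt_iff_lt, hfix]
      exact (h' j).1.2 hj
    · simp only [Function.comp, hz.lt_iff_lt, hfix]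
      exact (h' j).2.2 hj

lemma sum_perm_eq_of_side (z : Fin (m + 1 + r) → ℝ) {τ : Equiv.Perm (Fin (m + 1 + r))}
    (hτ : side m r ∘ τ = side m r) :
    z (τ (mid m r)) = z (mid m r) ∧
    (∑ j, if j < mid m r then z (τ j) else 0) = (∑ j, if j < mid m r then z j else 0) ∧
    (∑ j, if mid m r < j then z (τ j) else 0) = (∑ j, if mid m r < j then z j else 0) := by
  have h1 : ∀ j, τ j < mid m r ↔ j < mid m r := fun j => by
    rw [← cmp_eq_lt_iff, ← cmp_eq_lt_iff]
    exact (congrFun hτ j).congr_left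
  have h2 : ∀ j, mid m r < τ j ↔ mid m r < j := fun j => by
    rw [← cmp_eq_gt_iff, ← cmp_eq_gt_iff]
    exact (congrFun hτ j).congr_left
  refine ⟨?_, ?_, ?_⟩
  · have h3 := congrFun hτ (mid m r)
    simp only [Function.comp, side, cmp_self_eq_eq, cmp_eq_eq_iff] at h3
    rw [h3]
  · rw [← Equiv.sum_comp τ (fun j => if j < mid m r then z j else 0)]
    simp only [h1]
  · rw [← Equiv.sum_comp τ (fun j => if mid m r < j then z j else 0)]
    simp only [h2]

/-- `side` colours the indices with three colours, used `m`, `1` and `r` times; a colour-preserving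
permutation is a permutation of each class. -/
lemma card_side_stabilizer :
    Fintype.card {τ : Equiv.Perm (Fin (m + 1 + r)) // side m r ∘ τ = side m r} =
      m.factorial * r.factorial := by
  rw [DomMulAct.stabilizer_card]
  have h1 : Fintype.card {j // side m r j = Ordering.lt} = m := by
    rw [Fintype.card_subtype]
    have : (Finset.univ.filter fun j => side m r j = Ordering.lt) = Finset.Iio (mid m r) := by
      ext j; simp [side, cmp_eq_lt_iff]
    rw [this, Fin.card_Iio]; rfl
  have h2 : Fintype.card {j // side m r j = Ordering.gt} = r := by
    rw [Fintype.card_subtype]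
    have : (Finset.univ.filter fun j => side m r j = Ordering.gt) = Finset.Ioi (mid m r) := by
      ext j; simp [side, cmp_eq_gt_iff]
    rw [this, Fin.card_Ioi]; simp [mid]
  have h3 : Fintype.card {j // side m r j = Ordering.eq} = 1 := by
    rw [Fintype.card_subtype]
    have : (Finset.univ.filter fun j => side m r j = Ordering.eq) = {mid m r} := by
      ext j; simp [side, cmp_eq_eq_iff]
    rw [this, Finset.card_singleton]
  have hu : (Finset.univ : Finset Ordering) = {Ordering.lt, Ordering.eq, Ordering.gt} := by
    decide
  rw [hu, Finset.prod_insert (by decide), Finset.prod_insert (by decide), Finset.prod_singleton,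
    h1, h2, h3]
  simp

/-- The value of `F` at the entry in position `m`, the sum of the entries before it and the sum of
the entries after it, on `blockSet m r`. -/
def blockFun (F : ℝ × ℝ × ℝ → ENNReal) (x : Fin (m + 1 + r) → ℝ) : ENNReal :=
  (blockSet m r).indicator (fun x => F (x (mid m r), ∑ j, (if j < mid m r then x j else 0),
    ∑ j, (if mid m r < j then x j else 0))) x

lemma measurable_blockFun {F : ℝ × ℝ × ℝ → ENNReal} (hF : Measurable F) :
    Measurable (blockFun (m := m) (r := r) F) := by
  refine Measurable.indicator (hF.comp ?_) measurableSet_blockSet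
  refine (measurable_pi_apply _).prodMk (Measurable.prodMk ?_ ?_) <;>
  · refine Finset.measurable_sum _ fun j _ => ?_
    split_ifs <;> fun_prop

/-- The symmetrization identity. Passing to the sorted sample, the rearrangements in `blockSet` are
those preserving `side`; each has the pivot of the sample in the middle and its lower and upper sums
on the two sides. -/
lemma sum_blockFun_comp_perm (F : ℝ × ℝ × ℝ → ENNReal) {x : Fin (m + 1 + r) → ℝ}
    (hx : Function.Injective x) :
    ∑ τ : Equiv.Perm (Fin (m + 1 + r)), blockFun F (x ∘ τ) =
      (m.factorial * r.factorial : ℕ) *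
        F (pivot x (r + 1), trimmedSum x (r + 1), topSum x (r + 1)) := by
  set z := x ∘ Tuple.sort x with hz
  have hzm : StrictMono z :=
    (Tuple.monotone_sort x).strictMono_of_injective (hx.comp (Tuple.sort x).injective)
  rw [← Equiv.sum_comp (Equiv.mulLeft (Tuple.sort x))]
  have : ∀ τ : Equiv.Perm (Fin (m + 1 + r)),
      blockFun F (x ∘ (Equiv.mulLeft (Tuple.sort x) τ)) =
        if side m r ∘ τ = side m r then
          F (pivot x (r + 1), trimmedSum x (r + 1), topSum x (r + 1)) else 0 := by
    intro τ
    have e : x ∘ (Equiv.mulLeft (Tuple.sort x) τ) = z ∘ τ := rfl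
    rw [e, blockFun]
    split_ifs with h
    · rw [indicator_of_mem ((comp_perm_mem_blockSet_iff hzm τ).2 h), pivot_eq, trimmedSum_eq,
        topSum_eq]
      obtain ⟨h1, h2, h3⟩ := sum_perm_eq_of_side z h
      simp only [Function.comp_apply, h1, h2, h3]
      rfl
    · rw [indicator_of_notMem (fun hc => h ((comp_perm_mem_blockSet_iff hzm τ).1 hc))]
  rw [Finset.sum_congr rfl fun τ _ => this τ, ← Finset.sum_filter, Finset.sum_const,
    nsmul_eq_mul, ← card_side_stabilizer, Fintype.card_subtype]

/-- Two independent entries of an atomless law coincide with probability zero, by Fubini. -/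
lemma ae_injective_pi {n : ℕ} (μ : Measure ℝ) [IsProbabilityMeasure μ] [NullSingletonClass μ] :
    ∀ᵐ x ∂(Measure.pi fun _ : Fin n => μ), Function.Injective x := by
  have : ∀ i j : Fin n, i ≠ j → ∀ᵐ x ∂(Measure.pi fun _ : Fin n => μ), x i ≠ x j := by
    intro i j hij
    have hind : iIndepFun (fun i (x : Fin n → ℝ) => x i) (Measure.pi fun _ : Fin n => μ) :=
      iIndepFun_pi (X := fun _ x => x) (fun i => aemeasurable_id)
    have h2 := (indepFun_iff_map_prod_eq_prod_map_map (measurable_pi_apply i).aemeasurable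
      (measurable_pi_apply j).aemeasurable).1
      (hind.indepFun hij)
    simp only [(measurePreserving_eval (fun _ : Fin n => μ) _).map_eq] at h2
    have h3 : ∀ᵐ p ∂(μ.prod μ), p.1 ≠ p.2 := by
      rw [Measure.ae_prod_iff_ae_ae (by measurability)]
      filter_upwards with a
      filter_upwards [compl_mem_ae_iff.2 (measure_singleton (μ := μ) a)] with b hb using
        fun h => hb h.symm
    rw [← h2] at h3
    exact ae_of_ae_map (f := fun x : Fin n → ℝ => (x i, x j)) (p := fun q => q.1 ≠ q.2)
      (by fun_prop) h3
  have h' : ∀ᵐ x ∂(Measure.pi fun _ : Fin n => μ), ∀ i j : Fin n, i ≠ j → x i ≠ x j := by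
    simp only [ae_all_iff]
    exact this
  filter_upwards [h'] with x hx i j hij
  by_contra hne
  exact hx i j hne hij

/-- Integrate `sum_blockFun_comp_perm`: an iid sample is exchangeable, so all `(m + 1 + r)!` terms
have the same integral. The factorials stay on both sides to avoid division in `ENNReal`. -/
lemma lintegral_orderStat (μ : Measure ℝ) [IsProbabilityMeasure μ] [NullSingletonClass μ]
    {F : ℝ × ℝ × ℝ → ENNReal} (hF : Measurable F) :
    (m.factorial * r.factorial : ℕ) *
      ∫⁻ x, F (pivot x (r + 1), trimmedSum x (r + 1), topSum x (r + 1))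
        ∂(Measure.pi fun _ : Fin (m + 1 + r) => μ) =
    ((m + 1 + r).factorial : ℕ) *
      ∫⁻ x, blockFun F x ∂(Measure.pi fun _ : Fin (m + 1 + r) => μ) := by
  rw [← lintegral_const_mul' _ _ (ENNReal.natCast_ne_top _)]
  have h1 : ∫⁻ x, (m.factorial * r.factorial : ℕ) *
      F (pivot x (r + 1), trimmedSum x (r + 1), topSum x (r + 1))
        ∂(Measure.pi fun _ : Fin (m + 1 + r) => μ) =
      ∫⁻ x, ∑ τ : Equiv.Perm (Fin (m + 1 + r)), blockFun F (x ∘ τ)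
        ∂(Measure.pi fun _ : Fin (m + 1 + r) => μ) := by
    refine lintegral_congr_ae ?_
    filter_upwards [ae_injective_pi μ] with x hx
    rw [sum_blockFun_comp_perm F hx]
  have hmp : ∀ τ : Equiv.Perm (Fin (m + 1 + r)), MeasurePreserving (fun x : Fin (m + 1 + r) → ℝ => x ∘ τ)
      (Measure.pi fun _ : Fin (m + 1 + r) => μ) (Measure.pi fun _ : Fin (m + 1 + r) => μ) := by
    intro τ
    refine ⟨by fun_prop, ?_⟩
    have := (measurePreserving_piCongrLeft (fun _ : Fin (m + 1 + r) => μ) τ.symm).map_eq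
    rw [← this]
    congr 1
    ext x j
    simp [MeasurableEquiv.coe_piCongrLeft, Equiv.piCongrLeft_apply]
  have hmb : ∀ τ : Equiv.Perm (Fin (m + 1 + r)),
      Measurable fun x : Fin (m + 1 + r) → ℝ => blockFun F (x ∘ τ) := fun τ =>
    (measurable_blockFun hF).comp (hmp τ).measurable
  rw [h1, lintegral_finsetSum _ fun τ _ => hmb τ]
  have h2 : ∀ τ : Equiv.Perm (Fin (m + 1 + r)),
      ∫⁻ x, blockFun F (x ∘ τ) ∂(Measure.pi fun _ : Fin (m + 1 + r) => μ) =
        ∫⁻ x, blockFun F x ∂(Measure.pi fun _ : Fin (m + 1 + r) => μ) := fun τ =>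
    (hmp τ).lintegral_comp (measurable_blockFun hF)
  simp only [h2, Finset.sum_const, Finset.card_univ, Fintype.card_perm, Fintype.card_fin,
    nsmul_eq_mul]

/-- Concatenation of a block of size `m`, a pivot and a block of size `r`. -/
def glue (p : ℝ × (Fin m → ℝ) × (Fin r → ℝ)) : Fin (m + 1 + r) → ℝ :=
  Fin.append (Fin.snoc p.2.1 p.1 : Fin (m + 1) → ℝ) p.2.2

lemma glue_lower (p : ℝ × (Fin m → ℝ) × (Fin r → ℝ)) (i : Fin m) :
    glue p (Fin.castAdd r i.castSucc) = p.2.1 i := by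
  simp [glue]

lemma glue_mid (p : ℝ × (Fin m → ℝ) × (Fin r → ℝ)) :
    glue p (Fin.castAdd r (Fin.last m)) = p.1 := by
  simp only [glue, Fin.append_left, Fin.snoc_last]

lemma glue_upper (p : ℝ × (Fin m → ℝ) × (Fin r → ℝ)) (i : Fin r) :
    glue p (Fin.natAdd (m + 1) i) = p.2.2 i := by
  simp [glue]

lemma mid_eq : mid m r = Fin.castAdd r (Fin.last m) := rfl

lemma forall_fin_blocks {P : Fin (m + 1 + r) → Prop} :
    (∀ j, P j) ↔ (∀ i : Fin m, P (Fin.castAdd r i.castSucc)) ∧ P (Fin.castAdd r (Fin.last m)) ∧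
      ∀ i : Fin r, P (Fin.natAdd (m + 1) i) := by
  constructor
  · exact fun h => ⟨fun i => h _, h _, fun i => h _⟩
  · rintro ⟨h1, h2, h3⟩ j
    refine Fin.addCases (fun i => ?_) h3 j
    exact Fin.lastCases h2 h1 i

lemma sum_fin_blocks (f : Fin (m + 1 + r) → ℝ) :
    ∑ j, f j = ∑ i : Fin m, f (Fin.castAdd r i.castSucc) + f (Fin.castAdd r (Fin.last m)) +
      ∑ i : Fin r, f (Fin.natAdd (m + 1) i) := by
  rw [Fin.sum_univ_add, Fin.sum_univ_castSucc]

lemma measurable_glue : Measurable (glue : ℝ × (Fin m → ℝ) × (Fin r → ℝ) → _) := by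
  refine measurable_pi_iff.2 (forall_fin_blocks.2 ⟨fun i => ?_, ?_, fun i => ?_⟩)
  · simp only [glue_lower]; fun_prop
  · simp only [glue_mid]; fun_prop
  · simp only [glue_upper]; fun_prop

lemma map_glue (μ : Measure ℝ) [IsProbabilityMeasure μ] :
    (μ.prod ((Measure.pi fun _ : Fin m => μ).prod (Measure.pi fun _ : Fin r => μ))).map glue =
      Measure.pi fun _ : Fin (m + 1 + r) => μ := by
  symm
  refine Measure.pi_eq fun s hs => ?_
  rw [Measure.map_apply measurable_glue (MeasurableSet.univ_pi hs)]
  have : glue ⁻¹' (univ.pi s) = s (Fin.castAdd r (Fin.last m)) ×ˢ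
      ((univ.pi fun i : Fin m => s (Fin.castAdd r i.castSucc)) ×ˢ
        (univ.pi fun i : Fin r => s (Fin.natAdd (m + 1) i))) := by
    ext p
    simp only [mem_preimage, mem_univ_pi, mem_prod]
    rw [forall_fin_blocks]
    simp only [glue_lower, glue_mid, glue_upper]
    tauto
  rw [this, Measure.prod_prod, Measure.prod_prod, Measure.pi_pi, Measure.pi_pi,
    Fin.prod_univ_add, Fin.prod_univ_castSucc]
  ring

/-- For a fixed pivot the block condition becomes a product set, which lets the lower and upper
blocks be integrated separately. -/
lemma blockFun_glue (F : ℝ × ℝ × ℝ → ENNReal) (p : ℝ × (Fin m → ℝ) × (Fin r → ℝ)) :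
    blockFun F (glue p) =
      ((univ.pi fun _ => Iio p.1) ×ˢ (univ.pi fun _ => Ioi p.1)).indicator
        (fun q : (Fin m → ℝ) × (Fin r → ℝ) => F (p.1, ∑ i, q.1 i, ∑ i, q.2 i)) p.2 := by
  have e1 : ∀ i : Fin m, Fin.castAdd r i.castSucc < mid m r := fun i => by
    simp [mid, Fin.lt_def]
  have e2 : ∀ i : Fin r, mid m r < Fin.natAdd (m + 1) i := fun i => by
    simp [mid, Fin.lt_def]; omega
  have hmem : glue p ∈ blockSet m r ↔
      p.2 ∈ (univ.pi fun _ : Fin m => Iio p.1) ×ˢ (univ.pi fun _ : Fin r => Ioi p.1) := by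
    simp only [blockSet, mem_ofPred_eq, mem_prod, mem_univ_pi, mem_Iio, mem_Ioi]
    rw [forall_fin_blocks, forall_fin_blocks]
    simp only [e1, e2, gt_iff_lt, (e1 _).not_gt, (e2 _).not_gt, ← mid_eq, lt_irrefl, true_imp_iff,
      false_imp_iff, implies_true, and_true, true_and]
    rw [mid_eq]
    simp only [glue_lower, glue_mid, glue_upper]
  by_cases h : glue p ∈ blockSet m r
  · rw [blockFun, indicator_of_mem h, indicator_of_mem (hmem.1 h), sum_fin_blocks,
      sum_fin_blocks]
    simp only [e1, e2, (e1 _).not_gt, (e2 _).not_gt, ← mid_eq, lt_irrefl, if_true, if_false,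
      Finset.sum_const_zero, add_zero, zero_add]
    rw [mid_eq]
    simp only [glue_lower, glue_mid, glue_upper]
  · rw [blockFun, indicator_of_notMem h, indicator_of_notMem fun hc => h (hmem.2 hc)]

/-- Restricting each coordinate to `S` and normalizing it costs one factor `μ S`: the block is again
iid, with the conditioned law. -/
lemma restrict_pi_eq_smul_pi_cond (m : ℕ) (μ : Measure ℝ) [IsProbabilityMeasure μ] (S : Set ℝ)
    (hS : MeasurableSet S) :
    (Measure.pi fun _ : Fin m => μ).restrict (univ.pi fun _ => S) =
      μ S ^ m • Measure.pi fun _ : Fin m => μ[|S] := by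
  rw [Measure.restrict_pi_pi]
  refine Measure.pi_eq fun s hs => ?_
  simp only [Measure.smul_apply, Measure.pi_pi, smul_eq_mul]
  rw [← Fin.prod_const, ← Finset.prod_mul_distrib]
  refine Finset.prod_congr rfl fun i _ => ?_
  rw [mul_comm, cond_mul_eq_inter hS, Measure.restrict_apply (hs i), inter_comm]

/-- Fubini with the pivot outermost. The weight `μ (Iio y) ^ m * μ (Ioi y) ^ r` becomes part of the
density of the pivot, and the inner product measure is the conditional law of the two sums. -/
lemma lintegral_blockFun (μ : Measure ℝ) [IsProbabilityMeasure μ] {F : ℝ × ℝ × ℝ → ENNReal}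
    (hF : Measurable F) :
    ∫⁻ x, blockFun F x ∂(Measure.pi fun _ : Fin (m + 1 + r) => μ) =
      ∫⁻ y, μ (Iio y) ^ m * μ (Ioi y) ^ r *
        ∫⁻ q, F (y, q) ∂((sumLaw m μ[|Iio y]).prod (sumLaw r μ[|Ioi y])) ∂μ := by
  have hmb : Measurable fun p : ℝ × (Fin m → ℝ) × (Fin r → ℝ) => blockFun F (glue p) :=
    (measurable_blockFun hF).comp measurable_glue
  rw [← map_glue, lintegral_map (measurable_blockFun hF) measurable_glue,
    lintegral_prod _ hmb.aemeasurable]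
  refine lintegral_congr fun y => ?_
  simp only [blockFun_glue]
  rw [lintegral_indicator ((MeasurableSet.univ_pi fun _ => measurableSet_Iio).prod
      (MeasurableSet.univ_pi fun _ => measurableSet_Ioi)), ← Measure.prod_restrict,
    restrict_pi_eq_smul_pi_cond _ _ _ measurableSet_Iio,
    restrict_pi_eq_smul_pi_cond _ _ _ measurableSet_Ioi, Measure.prod_smul_left,
    Measure.prod_smul_right, lintegral_smul_measure, lintegral_smul_measure, smul_eq_mul,
    smul_eq_mul, ← mul_assoc]
  congr 1
  rw [sumLaw, sumLaw, Measure.map_prod_map _ _ (by fun_prop) (by fun_prop),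
    lintegral_map (by fun_prop) (by fun_prop)]
  rfl

end Blocks

/-! ### The Pareto law and its truncations -/

/-- Moving the support into the reference measure leaves a pure power as density, so that power
integrals apply; the ray can be open because its endpoint is null. -/
lemma paretoMeasure_eq_withDensity_restrict (t α : ℝ) :
    paretoMeasure t α = (volume.restrict (Ioi t)).withDensity
      (fun x => ENNReal.ofReal (α * t ^ α * x ^ (-(α + 1)))) := by
  rw [paretoMeasure, Measure.restrict_congr_set Ioi_ae_eq_Ici, ← withDensity_indicator measurableSet_Ici]
  congr 1
  ext x
  by_cases h : t ≤ x
  · rw [paretoPDF_of_le h, indicator_of_mem (mem_Ici.2 h)]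
  · rw [paretoPDF_of_lt (not_le.1 h), indicator_of_notMem (by simpa using h)]

instance (t α : ℝ) : NullSingletonClass (paretoMeasure t α) := by
  rw [paretoMeasure]; infer_instance

lemma paretoMeasure_Ioi {t α y : ℝ} (ht : 0 < t) (hα : 0 < α) (hy : t ≤ y) :
    paretoMeasure t α (Ioi y) = ENNReal.ofReal (t ^ α * y ^ (-α)) := by
  have hy0 : 0 < y := ht.trans_le hy
  rw [paretoMeasure_eq_withDensity_restrict, withDensity_apply _ measurableSet_Ioi,
    Measure.restrict_restrict measurableSet_Ioi, Ioi_inter_Ioi, sup_of_le_left hy,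
    ← ofReal_integral_eq_lintegral_ofReal]
  · rw [integral_const_mul, integral_Ioi_rpow_of_lt (by linarith) hy0]
    congr 1
    rw [show -(α + 1) + 1 = -α by ring]
    field_simp
  · exact (integrableOn_Ioi_rpow_of_lt (by linarith) hy0).const_mul _
  · filter_upwards [ae_restrict_mem measurableSet_Ioi] with x hx
    have : 0 < x := hy0.trans hx
    positivity

section One

variable {α y : ℝ}

lemma one_sub_rpow_neg_pos (hα : 0 < α) (hy : 1 < y) : 0 < 1 - y ^ (-α) := by
  have := Real.rpow_lt_one_of_one_lt_of_neg hy (neg_neg_of_pos hα)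
  linarith

lemma paretoMeasure_one_Iio (hα : 0 < α) (hy : 1 ≤ y) :
    paretoMeasure 1 α (Iio y) = ENNReal.ofReal (1 - y ^ (-α)) := by
  have := isProbabilityMeasure_paretoMeasure one_pos hα
  rw [measure_congr (Iio_ae_eq_Iic (μ := paretoMeasure 1 α) (a := y)), ← compl_Ioi,
    prob_compl_eq_one_sub measurableSet_Ioi, paretoMeasure_Ioi one_pos hα hy, Real.one_rpow,
    one_mul, ENNReal.ofReal_sub _ (by positivity), ENNReal.ofReal_one]

/-- The Pareto law conditioned to stay below `y`. -/
def below (α y : ℝ) : Measure ℝ := (paretoMeasure 1 α)[|Iio y]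

lemma isProbabilityMeasure_below (hα : 0 < α) (hy : 1 < y) :
    IsProbabilityMeasure (below α y) := by
  have := isProbabilityMeasure_paretoMeasure one_pos hα
  refine cond_isProbabilityMeasure ?_
  rw [paretoMeasure_one_Iio hα hy.le]
  simpa using one_sub_rpow_neg_pos hα hy

/-- Power tails are scale invariant: conditioning only changes the normalizing constant from `α` to
`α y ^ α`. This is why the top sum is a sum of exact Pareto variables. -/
lemma cond_Ioi_eq_paretoMeasure (hα : 0 < α) (hy : 1 < y) :
    (paretoMeasure 1 α)[|Ioi y] = paretoMeasure y α := by
  have hy0 : 0 < y := one_pos.trans hy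
  rw [ProbabilityTheory.cond, paretoMeasure_Ioi one_pos hα hy.le, paretoMeasure_eq_withDensity_restrict,
    restrict_withDensity measurableSet_Ioi, Measure.restrict_restrict measurableSet_Ioi,
    Ioi_inter_Ioi, sup_of_le_left hy.le, paretoMeasure_eq_withDensity_restrict,
    ← withDensity_smul _ (by fun_prop)]
  congr 1
  ext x
  simp only [Pi.smul_apply, smul_eq_mul, Real.one_rpow, one_mul, mul_one]
  rw [← ENNReal.ofReal_inv_of_pos (by positivity), ← ENNReal.ofReal_mul (by positivity),
    Real.rpow_neg hy0.le, inv_inv]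
  ring_nf

lemma ae_below (α y : ℝ) : ∀ᵐ x ∂(below α y), 1 < x ∧ x < y := by
  have h1 : ∀ᵐ x ∂(below α y), x ∈ Iio y := ae_cond_mem measurableSet_Iio
  have h2 : ∀ᵐ x ∂(paretoMeasure 1 α), x ∈ Ioi 1 := by
    rw [paretoMeasure_eq_withDensity_restrict]
    exact withDensity_absolutelyContinuous _ _ (ae_restrict_mem measurableSet_Ioi)
  have h3 : ∀ᵐ x ∂(below α y), x ∈ Ioi 1 := cond_absolutelyContinuous h2
  filter_upwards [h1, h3] with x hx1 hx2 using ⟨hx2, hx1⟩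

lemma integral_below (hα : 0 < α) (hy : 1 < y) (g : ℝ → ℝ) :
    ∫ x, g x ∂(below α y) =
      (1 - y ^ (-α))⁻¹ * ∫ x in (1 : ℝ)..y, α * x ^ (-(α + 1)) * g x := by
  have hw := one_sub_rpow_neg_pos hα hy
  rw [below, ProbabilityTheory.cond, paretoMeasure_one_Iio hα hy.le, integral_smul_measure, ENNReal.toReal_inv,
    ENNReal.toReal_ofReal hw.le, smul_eq_mul, paretoMeasure_eq_withDensity_restrict,
    restrict_withDensity measurableSet_Iio, Measure.restrict_restrict measurableSet_Iio,
    Iio_inter_Ioi, integral_withDensity_eq_integral_toReal_smul (by fun_prop)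
      (ae_of_all _ fun _ => ENNReal.ofReal_lt_top), intervalIntegral.integral_of_le hy.le,
    integral_Ioc_eq_integral_Ioo]
  congr 1
  refine setIntegral_congr_fun measurableSet_Ioo fun x hx => ?_
  have hx0 : 0 < x := one_pos.trans hx.1
  simp only [Real.one_rpow, mul_one, smul_eq_mul]
  rw [ENNReal.toReal_ofReal (by positivity)]

lemma integral_rpow_one {s : ℝ} (hs : s ≠ -1) (hy : 1 < y) :
    ∫ x in (1 : ℝ)..y, x ^ s = (y ^ (s + 1) - 1) / (s + 1) := by
  rw [integral_rpow (Or.inr ⟨hs, by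
    rw [uIcc_of_le hy.le]; exact fun h => absurd h.1 (by norm_num)⟩), Real.one_rpow]

lemma integral_rpow_neg_one (hy : 1 < y) : ∫ x in (1 : ℝ)..y, x ^ (-1 : ℝ) = Real.log y := by
  simp only [Real.rpow_neg_one]
  rw [integral_inv_of_pos one_pos (by linarith), div_one]

lemma integral_below_pow (hα : 0 < α) (hy : 1 < y) (d : ℕ) :
    ∫ x, x ^ d ∂(below α y) =
      (1 - y ^ (-α))⁻¹ * (α * ∫ x in (1 : ℝ)..y, x ^ ((d : ℝ) - (α + 1))) := by
  rw [integral_below hα hy]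
  congr 1
  rw [← intervalIntegral.integral_const_mul]
  refine intervalIntegral.integral_congr (E := ℝ) fun x hx => ?_
  rw [uIcc_of_le hy.le] at hx
  have hx0 : 0 < x := one_pos.trans_le hx.1
  rw [show (d : ℝ) - (α + 1) = -(α + 1) + d by ring, Real.rpow_add hx0, Real.rpow_natCast]
  ring

/-- In `condMean 1 0` and `condVar 1 0` the factor `n - k` is one, so they stand for the moments of
a single entry below `y`. The exceptional cases are those where a moment integrates `x ^ (-1)`: the
mean at `α = 1`, the second moment at `α = 2`. -/
lemma integral_id_below (hα : 0 < α) (hy : 1 < y) :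
    ∫ x, x ∂(below α y) = condMean 1 0 α y := by
  have h := integral_below_pow hα hy 1
  simp only [pow_one, Nat.cast_one] at h
  rw [h, condMean]
  have hw := one_sub_rpow_neg_pos hα hy
  split_ifs with h1
  · subst h1
    rw [show (1 : ℝ) - (1 + 1) = -1 by norm_num, integral_rpow_neg_one hy]
    simp
  · rw [integral_rpow_one (by intro hc; apply h1; linarith) hy,
      show 1 - (α + 1) + 1 = 1 - α by ring]
    have h2 : 1 - α ≠ 0 := fun hc => h1 (by linarith)
    have h3 : 1 - 1 / α ≠ 0 := by
      rw [sub_ne_zero, ne_eq, eq_div_iff hα.ne', one_mul]; exact h1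
    have h4 : α - 1 ≠ 0 := fun hc => h1 (by linarith)
    push_cast
    field_simp
    ring

lemma memLp_below (hα : 0 < α) (hy : 1 < y) : MemLp id 2 (below α y) := by
  have := isProbabilityMeasure_below hα hy
  refine MemLp.of_bound (by fun_prop) y ?_
  filter_upwards [ae_below α y] with x hx
  rw [id, Real.norm_of_nonneg (by linarith)]
  exact hx.2.le

lemma variance_below (hα : 0 < α) (hy : 1 < y) :
    variance id (below α y) = condVar 1 0 α y := by
  have := isProbabilityMeasure_below hα hy
  have hw := one_sub_rpow_neg_pos hα hy
  have hy0 : 0 < y := one_pos.trans hy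
  have hy1 : y - 1 ≠ 0 := by linarith
  rw [variance_eq_sub (memLp_below hα hy)]
  have h := integral_below_pow hα hy 2
  have h' := integral_id_below hα hy
  simp only [Pi.pow_apply, id]
  rw [h, h', condVar, condMean]
  split_ifs with h1 h2
  · subst h1
    rw [show ((2 : ℕ) : ℝ) - (1 + 1) = 0 by norm_num]
    simp only [Real.rpow_zero, intervalIntegral.integral_const, smul_eq_mul, Real.rpow_neg_one]
    have e : 1 - y⁻¹ = (y - 1) / y := by field_simp
    rw [e]
    push_cast
    field_simp
    ring
  · subst h2
    rw [show ((2 : ℕ) : ℝ) - (2 + 1) = -1 by norm_num, integral_rpow_neg_one hy]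
    have e1 : y ^ (-2 : ℝ) = (y ^ 2)⁻¹ := by
      rw [Real.rpow_neg hy0.le]; norm_num
    have e2 : y ^ (1 - 2 : ℝ) = y⁻¹ := by
      rw [show (1 - 2 : ℝ) = -1 by norm_num, Real.rpow_neg_one]
    rw [e1, e2]
    have hy2 : y ^ 2 - 1 ≠ 0 := by nlinarith
    have hy3 : y + 1 ≠ 0 := by linarith
    have e3 : 1 - (y ^ 2)⁻¹ = (y - 1) * (y + 1) / y ^ 2 := by field_simp; ring
    have e4 : y ^ 2 - 1 = (y - 1) * (y + 1) := by ring
    rw [e3, e4]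
    push_cast
    field_simp
    ring
  · rw [integral_rpow_one (by intro hc; apply h2; push_cast at hc; linarith) hy]
    rw [show ((2 : ℕ) : ℝ) - (α + 1) + 1 = 2 - α by push_cast; ring]
    have h3 : α - 1 ≠ 0 := fun hc => h1 (by linarith)
    have h4 : α - 2 ≠ 0 := fun hc => h2 (by linarith)
    have h5 : 2 - α ≠ 0 := fun hc => h2 (by linarith)
    have e1 : 1 - 1 / α = (α - 1) / α := by field_simp
    have e2 : 1 - 2 / α = (α - 2) / α := by field_simp
    rw [e1, e2]
    push_cast
    field_simp
    ring

lemma condMean_eq_mul (n k : ℕ) (α y : ℝ) :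
    condMean n k α y = ((n : ℝ) - k) * condMean 1 0 α y := by
  simp only [condMean]; push_cast; ring

lemma condVar_eq_mul (n k : ℕ) (α y : ℝ) :
    condVar n k α y = ((n : ℝ) - k) * condVar 1 0 α y := by
  simp only [condVar]; push_cast; split_ifs <;> ring

/-- Positivity need not be read off the formula: zero variance would make the truncated law a point
mass, but it is absolutely continuous with respect to an atomless law. -/
lemma condVar_one_pos (hα : 0 < α) (hy : 1 < y) : 0 < condVar 1 0 α y := by
  have := isProbabilityMeasure_below hα hy
  have := isProbabilityMeasure_paretoMeasure one_pos hα
  rw [← variance_below hα hy]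
  refine lt_of_le_of_ne (variance_nonneg _ _) fun h => ?_
  have h1 := ae_eq_integral_of_variance_eq_zero (memLp_below hα hy) h.symm
  have h2 : ∀ᵐ x ∂(below α y), x ≠ (below α y)[id] := by
    have : (below α y) ≪ paretoMeasure 1 α := cond_absolutelyContinuous
    exact this (compl_mem_ae_iff.2 (measure_singleton _))
  obtain ⟨x, hx1, hx2⟩ := (h1.and h2).exists
  exact hx2 hx1

end One

/-! ### Moments of sums -/

lemma memLp_eval_pi {N : ℕ} {ν : Measure ℝ} [IsProbabilityMeasure ν] (h : MemLp id 2 ν)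
    (i : Fin N) : MemLp (fun x : Fin N → ℝ => x i) 2 (Measure.pi fun _ : Fin N => ν) :=
  h.comp_measurePreserving (measurePreserving_eval (fun _ : Fin N => ν) i)

lemma memLp_sumLaw {N : ℕ} {ν : Measure ℝ} [IsProbabilityMeasure ν] (h : MemLp id 2 ν) :
    MemLp id 2 (sumLaw N ν) := by
  rw [sumLaw, memLp_map_measure_iff (by fun_prop) (by fun_prop)]
  exact memLp_finsetSum (f := fun i (x : Fin N → ℝ) => x i) Finset.univ fun i _ =>
    memLp_eval_pi h i

lemma integral_sumLaw {N : ℕ} {ν : Measure ℝ} [IsProbabilityMeasure ν] (h : MemLp id 2 ν) :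
    ∫ x, x ∂(sumLaw N ν) = N * ∫ x, x ∂ν := by
  rw [sumLaw, integral_map (by fun_prop) (by fun_prop), integral_finsetSum _ fun i _ =>
    (memLp_eval_pi h i).integrable (by norm_num)]
  have : ∀ i : Fin N, ∫ x, x i ∂(Measure.pi fun _ : Fin N => ν) = ∫ x, x ∂ν := fun i =>
    integral_comp_eval (μ := fun _ : Fin N => ν) (f := fun x => x) (by fun_prop)
  simp [this]

lemma variance_sumLaw {N : ℕ} {ν : Measure ℝ} [IsProbabilityMeasure ν] (h : MemLp id 2 ν) :
    variance id (sumLaw N ν) = N * variance id ν := by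
  rw [sumLaw, variance_map (by fun_prop) (by fun_prop)]
  have := variance_sum_pi (μ := fun _ : Fin N => ν) (X := fun _ => id) (fun _ => h)
  simp only [Finset.sum_const, Finset.card_univ, Fintype.card_fin, nsmul_eq_mul] at this
  rw [← this]
  congr 1
  ext x
  simp

/-! ### Densities of convolutions -/

lemma sumLaw_zero (ν : Measure ℝ) [IsProbabilityMeasure ν] : sumLaw 0 ν = Measure.dirac 0 := by
  refine Measure.ext_of_charFun ?_
  ext t
  simp [charFun_sumLaw, charFun_dirac]

lemma sumLaw_one (ν : Measure ℝ) [IsProbabilityMeasure ν] : sumLaw 1 ν = ν := by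
  refine Measure.ext_of_charFun ?_
  ext t
  rw [charFun_sumLaw, pow_one]

lemma sumLaw_succ (N : ℕ) (ν : Measure ℝ) [IsProbabilityMeasure ν] :
    sumLaw (N + 1) ν = sumLaw N ν ∗ ν := by
  refine Measure.ext_of_charFun ?_
  ext t
  rw [charFun_conv, charFun_sumLaw, charFun_sumLaw, pow_succ]

lemma conv_apply (f g : ℝ → ℝ) (x : ℝ) : conv f g x = ∫ t, f t * g (x - t) := rfl

lemma conv_nonneg {f g : ℝ → ℝ} (hf : 0 ≤ f) (hg : 0 ≤ g) : 0 ≤ conv f g := fun x => by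
  rw [conv_apply]
  exact integral_nonneg fun t => mul_nonneg (hf t) (hg _)

lemma integrable_conv {f g : ℝ → ℝ} (hf : Integrable f) (hg : Integrable g) :
    Integrable (conv f g) :=
  hf.integrable_convolution (ContinuousLinearMap.mul ℝ ℝ) hg

lemma withDensity_conv_withDensity {f g : ℝ → ℝ} (hf : Integrable f) (hg : Integrable g)
    (hf0 : 0 ≤ f) (hg0 : 0 ≤ g) :
    (volume.withDensity fun x => ENNReal.ofReal (f x)) ∗
        (volume.withDensity fun x => ENNReal.ofReal (g x)) =
      volume.withDensity fun x => ENNReal.ofReal (conv f g x) := by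
  rw [conv_withDensity_eq_mlconvolution₀ hf.aemeasurable.ennreal_ofReal
    hg.aemeasurable.ennreal_ofReal]
  refine withDensity_congr_ae ?_
  -- The Bochner integral in `conv` takes the default value zero where its integrand is not
  -- integrable; for integrable `f` and `g` this happens only on a null set.
  filter_upwards [hf.ae_convolution_exists (ContinuousLinearMap.mul ℝ ℝ) hg] with x hx
  have hx' : Integrable fun t => f t * g (x - t) := hx
  rw [lconvolution_def, conv_apply, ofReal_integral_eq_lintegral_ofReal hx'
    (ae_of_all _ fun t => mul_nonneg (hf0 t) (hg0 _))]
  refine lintegral_congr fun t => ?_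
  rw [ENNReal.ofReal_mul (hf0 t), neg_add_eq_sub]

lemma convPow_spec {f : ℝ → ℝ} (hf : Integrable f) (hf0 : 0 ≤ f)
    [IsProbabilityMeasure (volume.withDensity fun x => ENNReal.ofReal (f x))] (N : ℕ) :
    Integrable (convPow f (N + 1)) ∧ 0 ≤ convPow f (N + 1) ∧
      sumLaw (N + 1) (volume.withDensity fun x => ENNReal.ofReal (f x)) =
        volume.withDensity fun x => ENNReal.ofReal (convPow f (N + 1) x) := by
  induction N with
  | zero => exact ⟨hf, hf0, sumLaw_one _⟩
  | succ N ih =>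
    obtain ⟨h1, h2, h3⟩ := ih
    refine ⟨integrable_conv h1 hf, conv_nonneg h2 hf0, ?_⟩
    rw [sumLaw_succ, h3, withDensity_conv_withDensity h1 hf h2 hf0]
    rfl

/-! ### The density of the top sum, and the inner integral as a probability -/

section Upper

variable {α y : ℝ}

lemma upperPDF_nonneg (hα : 0 < α) (hy : 0 < y) : 0 ≤ upperPDF α y :=
  fun x => paretoPDFReal_nonneg hy.le hα.le x

lemma integrable_upperPDF (hα : 0 < α) (hy : 0 < y) : Integrable (upperPDF α y) := by
  refine ⟨(measurable_paretoPDFReal y α).aestronglyMeasurable, ?_⟩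
  rw [hasFiniteIntegral_iff_ofReal (ae_of_all _ (upperPDF_nonneg hα hy))]
  have := lintegral_paretoPDF_eq_one hy hα
  simp only [paretoPDF] at this
  simp only [upperPDF, this, ENNReal.one_lt_top]

lemma convPow_upperPDF_spec (hα : 0 < α) (hy : 0 < y) (N : ℕ) :
    Integrable (convPow (upperPDF α y) (N + 1)) ∧ 0 ≤ convPow (upperPDF α y) (N + 1) ∧
      sumLaw (N + 1) (paretoMeasure y α) =
        volume.withDensity fun x => ENNReal.ofReal (convPow (upperPDF α y) (N + 1) x) := by
  have : IsProbabilityMeasure (volume.withDensity fun x => ENNReal.ofReal (upperPDF α y x)) :=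
    isProbabilityMeasure_paretoMeasure hy hα
  exact convPow_spec (integrable_upperPDF hα hy) (upperPDF_nonneg hα hy) N

lemma withDensity_real_Ioc {f : ℝ → ℝ} (hf : Integrable f) (hf0 : 0 ≤ f) {s : ℝ} (hs : 0 ≤ s) :
    (volume.withDensity fun x => ENNReal.ofReal (f x)).real (Ioc 0 s) = ∫ v in (0 : ℝ)..s, f v := by
  rw [measureReal_def, withDensity_apply _ measurableSet_Ioc,
    ← ofReal_integral_eq_lintegral_ofReal hf.integrableOn (ae_of_all _ hf0),
    ENNReal.toReal_ofReal (integral_nonneg hf0), intervalIntegral.integral_of_le hs]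

/-- Unifies the two cases of the definition: for `k = 1` the top sum is empty, its law is the Dirac
mass at zero, and the convolution is the normal law itself. -/
lemma normexInner_eq {n r : ℕ} {s : ℝ} (hα : 0 < α) (hy : 0 < y)
    (hv : 0 < condVar n (r + 1) α y) (hs : 0 ≤ s) :
    normexInner n (r + 1) α y s =
      (condNormal n (r + 1) α y ∗ sumLaw r (paretoMeasure y α)).real (Ioc 0 s) := by
  have hP := isProbabilityMeasure_paretoMeasure hy hα
  have hv' : (condVar n (r + 1) α y).toNNReal ≠ 0 := by simpa using hv
  have hgd : condNormal n (r + 1) α y = volume.withDensity fun x => ENNReal.ofReal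
      (gaussianPDFReal (condMean n (r + 1) α y) (condVar n (r + 1) α y).toNNReal x) :=
    gaussianReal_of_var_ne_zero _ hv'
  have hg0 : 0 ≤ gaussianPDFReal (condMean n (r + 1) α y) (condVar n (r + 1) α y).toNNReal :=
    fun x => gaussianPDFReal_nonneg _ _ x
  rcases r with _ | r
  · rw [sumLaw_zero, normexInner, if_pos (by rfl)]
    have : SFinite (condNormal n (0 + 1) α y) := by rw [condNormal]; infer_instance
    rw [Measure.conv_dirac_zero, hgd, withDensity_real_Ioc (integrable_gaussianPDFReal _ _) hg0 hs,
      ← intervalIntegral.integral_const_mul]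
    refine intervalIntegral.integral_congr fun v _ => ?_
    simp only [gaussianPDFReal, condStd, NNReal.coe_one, mul_one, sub_zero,
      Real.coe_toNNReal _ hv.le, div_pow, Real.sq_sqrt hv.le]
    rw [Real.sqrt_mul (by positivity) (condVar n (0 + 1) α y), mul_inv]
    have : -((v - condMean n (0 + 1) α y) ^ 2 / condVar n (0 + 1) α y) / 2 =
      -(v - condMean n (0 + 1) α y) ^ 2 / (2 * condVar n (0 + 1) α y) := by
        field_simp
    rw [this]
    ring
  · obtain ⟨h1, h2, h3⟩ := convPow_upperPDF_spec hα hy r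
    rw [normexInner, if_neg (by omega), h3, hgd,
      withDensity_conv_withDensity (integrable_gaussianPDFReal _ _) h1 hg0 h2,
      withDensity_real_Ioc (integrable_conv (integrable_gaussianPDFReal _ _) h1)
        (conv_nonneg hg0 h2) hs]
    rfl

end Upper

/-! ### Measurability of order statistics -/

/-- The entry of index `j` in the sorted sample is at most `t` exactly when more than `j` entries
are; this count does not involve the sorting permutation. -/
lemma measurable_comp_sort {n : ℕ} (j : Fin n) :
    Measurable fun x : Fin n → ℝ => x (Tuple.sort x j) := by
  refine measurable_of_Iic fun t => ?_
  have : (fun x : Fin n → ℝ => x (Tuple.sort x j)) ⁻¹' Iic t =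
      {x | (j : ℕ) < ∑ i, if x i ≤ t then 1 else 0} := by
    ext x
    have h := Tuple.lt_card_le_iff_apply_le_of_monotone (f := x ∘ Tuple.sort x) (a := t) (j := j)
      (Tuple.monotone_sort x)
    rw [Finset.card_filter] at h
    have h2 := Equiv.sum_comp (Tuple.sort x) (fun i => if x i ≤ t then 1 else 0)
    simp only [Function.comp] at h
    rw [h2] at h
    exact h.symm
  rw [this]
  refine measurableSet_lt measurable_const (Finset.measurable_sum _ fun i _ => ?_)
  exact Measurable.ite (measurableSet_le (measurable_pi_apply i) measurable_const)
    measurable_const measurable_const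

lemma measurable_orderStat {n : ℕ} (i : ℕ) :
    Measurable fun x : Fin n → ℝ => orderStat x i := by
  by_cases h : 1 ≤ i ∧ i ≤ n
  · simp only [orderStat, dif_pos h]
    exact measurable_comp_sort _
  · simp only [orderStat, dif_neg h]
    exact measurable_const

lemma measurable_pivot {n : ℕ} (k : ℕ) : Measurable fun x : Fin n → ℝ => pivot x k :=
  measurable_orderStat _

lemma measurable_trimmedSum {n : ℕ} (k : ℕ) : Measurable fun x : Fin n → ℝ => trimmedSum x k :=
  Finset.measurable_sum _ fun _ _ => measurable_orderStat _

lemma measurable_topSum {n : ℕ} (k : ℕ) : Measurable fun x : Fin n → ℝ => topSum x k :=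
  Finset.measurable_sum _ fun _ _ => measurable_orderStat _

/-! ### Kernels of sums -/

lemma measurable_pi_of_measurable {N : ℕ} {κ : ℝ → Measure ℝ} [∀ y, IsProbabilityMeasure (κ y)]
    (hκ : Measurable κ) : Measurable fun y => Measure.pi fun _ : Fin N => κ y := by
  refine Measurable.measure_of_isPiSystem_of_isProbabilityMeasure generateFrom_pi.symm
    isPiSystem_pi ?_
  rintro _ ⟨s, hs, rfl⟩
  simp only [Measure.pi_pi]
  refine Finset.measurable_prod _ fun i _ => ?_
  have hi : MeasurableSet (s i) := hs i (mem_univ i)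
  exact (Measure.measurable_coe hi).comp hκ

lemma measurable_sumLaw {N : ℕ} {κ : ℝ → Measure ℝ} [∀ y, IsProbabilityMeasure (κ y)]
    (hκ : Measurable κ) : Measurable fun y => sumLaw N (κ y) :=
  (Measure.measurable_map _ (by fun_prop)).comp (measurable_pi_of_measurable hκ)

lemma measurable_cond (μ : Measure ℝ) [SFinite μ] {S : Set (ℝ × ℝ)} (hS : MeasurableSet S) :
    Measurable fun y => μ[|Prod.mk y ⁻¹' S] := by
  refine Measure.measurable_of_measurable_coe _ fun s hs => ?_
  simp only [cond_apply (measurable_prodMk_left hS)]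
  refine (measurable_measure_prodMk_left hS).inv.mul ?_
  exact measurable_measure_prodMk_left (hS.inter (measurable_snd hs))

section Kernels

variable {α : ℝ}

/-- The law of the entries below the pivot `y`, extended by a point mass for `y ≤ 1`. -/
def lowerLaw (α y : ℝ) : Measure ℝ := if 1 < y then below α y else Measure.dirac 0

/-- The law of the entries above the pivot `y`, extended by a point mass for `y ≤ 1`. -/
def upperLaw (α y : ℝ) : Measure ℝ := if 1 < y then paretoMeasure y α else Measure.dirac 0

lemma lowerLaw_of_one_lt {y : ℝ} (hy : 1 < y) : lowerLaw α y = below α y := if_pos hy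

lemma upperLaw_of_one_lt {y : ℝ} (hy : 1 < y) : upperLaw α y = paretoMeasure y α := if_pos hy

lemma isProbabilityMeasure_lowerLaw (hα : 0 < α) (y : ℝ) :
    IsProbabilityMeasure (lowerLaw α y) := by
  by_cases hy : 1 < y
  · rw [lowerLaw_of_one_lt hy]; exact isProbabilityMeasure_below hα hy
  · rw [lowerLaw, if_neg hy]; infer_instance

lemma isProbabilityMeasure_upperLaw (hα : 0 < α) (y : ℝ) :
    IsProbabilityMeasure (upperLaw α y) := by
  by_cases hy : 1 < y
  · rw [upperLaw_of_one_lt hy]; exact isProbabilityMeasure_paretoMeasure (by linarith) hα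
  · rw [upperLaw, if_neg hy]; infer_instance

lemma measurable_lowerLaw (hα : 0 < α) : Measurable (lowerLaw α) := by
  have := isProbabilityMeasure_paretoMeasure one_pos hα
  refine Measurable.ite measurableSet_Ioi ?_ measurable_const
  exact measurable_cond (paretoMeasure 1 α) (S := {p | p.2 < p.1})
    (measurableSet_lt measurable_snd measurable_fst)

lemma measurable_upperLaw (hα : 0 < α) : Measurable (upperLaw α) := by
  have := isProbabilityMeasure_paretoMeasure one_pos hα
  have h : upperLaw α = fun y => if 1 < y then (paretoMeasure 1 α)[|Ioi y] else Measure.dirac 0 := by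
    ext1 y
    by_cases hy : 1 < y
    · rw [upperLaw_of_one_lt hy, if_pos hy, cond_Ioi_eq_paretoMeasure hα hy]
    · rw [upperLaw, if_neg hy, if_neg hy]
  rw [h]
  refine Measurable.ite measurableSet_Ioi ?_ measurable_const
  exact measurable_cond (paretoMeasure 1 α) (S := {p | p.1 < p.2})
    (measurableSet_lt measurable_fst measurable_snd)

/-- The conditional law of the sum of the `m` smallest entries given the pivot. -/
def lowerKernel (hα : 0 < α) (m : ℕ) : Kernel ℝ ℝ where
  toFun y := sumLaw m (lowerLaw α y)
  measurable' :=
    have := isProbabilityMeasure_lowerLaw hα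
    measurable_sumLaw (measurable_lowerLaw hα)

/-- The conditional law of the sum of the `r` largest entries given the pivot. -/
def upperKernel (hα : 0 < α) (r : ℕ) : Kernel ℝ ℝ where
  toFun y := sumLaw r (upperLaw α y)
  measurable' :=
    have := isProbabilityMeasure_upperLaw hα
    measurable_sumLaw (measurable_upperLaw hα)

lemma lowerKernel_apply (hα : 0 < α) (m : ℕ) (y : ℝ) :
    lowerKernel hα m y = sumLaw m (lowerLaw α y) := rfl

lemma upperKernel_apply (hα : 0 < α) (r : ℕ) (y : ℝ) :
    upperKernel hα r y = sumLaw r (upperLaw α y) := rfl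

instance (hα : 0 < α) (m : ℕ) : IsMarkovKernel (lowerKernel hα m) where
  isProbabilityMeasure y := by
    have := isProbabilityMeasure_lowerLaw hα y
    rw [lowerKernel_apply]; infer_instance

instance (hα : 0 < α) (r : ℕ) : IsMarkovKernel (upperKernel hα r) where
  isProbabilityMeasure y := by
    have := isProbabilityMeasure_upperLaw hα y
    rw [upperKernel_apply]; infer_instance

/-! ### The law of the pivot -/

lemma measurable_orderStatPDF (n i : ℕ) (α : ℝ) : Measurable (orderStatPDF n i α) := by
  unfold orderStatPDF
  fun_prop

/-- With `n = m + 1 + r` and `k = r + 1` the truncated subtractions disappear; hence this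
parametrization of the samples. -/
lemma orderStatPDF_eq (m r : ℕ) (α y : ℝ) :
    orderStatPDF (m + 1 + r) (m + 1) α y =
      ((m + 1 + r).factorial : ℝ) / (m.factorial * r.factorial) * α * (1 - y ^ (-α)) ^ m *
        y ^ (-(α * (r + 1)) - 1) := by
  have h : m + 1 + r - (m + 1) = r := by omega
  rw [orderStatPDF, h, Nat.add_sub_cancel]
  congr 2
  push_cast
  ring

lemma orderStatPDF_pos (hα : 0 < α) (m r : ℕ) {y : ℝ} (hy : 1 < y) :
    0 < orderStatPDF (m + 1 + r) (m + 1) α y := by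
  have := one_sub_rpow_neg_pos hα hy
  have hy0 : 0 < y := one_pos.trans hy
  rw [orderStatPDF_eq]
  positivity

/-- The law of the pivot in a sample of size `m + 1 + r`. -/
def pivotLaw (α : ℝ) (m r : ℕ) : Measure ℝ :=
  (volume.restrict (Ioi 1)).withDensity
    (fun y => ENNReal.ofReal (orderStatPDF (m + 1 + r) (m + 1) α y))

instance (α : ℝ) (m r : ℕ) : SFinite (pivotLaw α m r) := by
  rw [pivotLaw]; infer_instance

lemma lintegral_pivotLaw (α : ℝ) (m r : ℕ) (g : ℝ → ENNReal) :
    ∫⁻ y, g y ∂(pivotLaw α m r) =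
      ∫⁻ y in Ioi 1, ENNReal.ofReal (orderStatPDF (m + 1 + r) (m + 1) α y) * g y := by
  rw [pivotLaw, lintegral_withDensity_eq_lintegral_mul_non_measurable _
    (measurable_orderStatPDF _ _ _).ennreal_ofReal (ae_of_all _ fun _ => ENNReal.ofReal_lt_top)]
  rfl

/-- The density is `n! / (m! r!)` times the Pareto density at `y` times the probabilities that `m`
entries fall below `y` and `r` above it, as in `lintegral_blockFun`. -/
lemma factorial_mul_orderStatPDF (hα : 0 < α) (m r : ℕ) {y : ℝ} (hy : 1 < y) :
    ((m.factorial * r.factorial : ℕ) : ENNReal) *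
        ENNReal.ofReal (orderStatPDF (m + 1 + r) (m + 1) α y) =
      ((m + 1 + r).factorial : ℕ) * (ENNReal.ofReal (α * 1 ^ α * y ^ (-(α + 1))) *
        (paretoMeasure 1 α (Iio y) ^ m * paretoMeasure 1 α (Ioi y) ^ r)) := by
  have hw := one_sub_rpow_neg_pos hα hy
  have hy0 : 0 < y := one_pos.trans hy
  rw [paretoMeasure_one_Iio hα hy.le, paretoMeasure_Ioi one_pos hα hy.le, Real.one_rpow, one_mul,
    mul_one, ← ENNReal.ofReal_pow hw.le, ← ENNReal.ofReal_pow (by positivity),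
    ← ENNReal.ofReal_mul (by positivity), ← ENNReal.ofReal_mul (by positivity),
    ← ENNReal.ofReal_natCast, ← ENNReal.ofReal_natCast, ← ENNReal.ofReal_mul (by positivity),
    ← ENNReal.ofReal_mul (by positivity), orderStatPDF_eq]
  congr 1
  have e : y ^ (-(α * (r + 1)) - 1) = y ^ (-(α + 1)) * (y ^ (-α)) ^ r := by
    rw [← Real.rpow_natCast, ← Real.rpow_mul hy0.le, ← Real.rpow_add hy0]
    congr 1
    ring
  rw [e]
  push_cast
  field_simp

/-- Disintegration of the sample along the pivot. -/
theorem map_orderStat (hα : 0 < α) (m r : ℕ) :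
    (Measure.pi fun _ : Fin (m + 1 + r) => paretoMeasure 1 α).map
      (fun x => (pivot x (r + 1), trimmedSum x (r + 1), topSum x (r + 1))) =
      pivotLaw α m r ⊗ₘ (lowerKernel hα m ×ₖ upperKernel hα r) := by
  have := isProbabilityMeasure_paretoMeasure one_pos hα
  have hmeas : Measurable fun x : Fin (m + 1 + r) → ℝ =>
      (pivot x (r + 1), trimmedSum x (r + 1), topSum x (r + 1)) :=
    (measurable_pivot _).prodMk ((measurable_trimmedSum _).prodMk (measurable_topSum _))
  ext s hs
  have h1 := lintegral_orderStat (m := m) (r := r) (paretoMeasure 1 α)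
    (F := s.indicator 1) (measurable_one.indicator hs)
  rw [lintegral_blockFun _ (measurable_one.indicator hs)] at h1
  have e1 : ∫⁻ x, s.indicator 1 (pivot x (r + 1), trimmedSum x (r + 1), topSum x (r + 1))
      ∂(Measure.pi fun _ : Fin (m + 1 + r) => paretoMeasure 1 α) =
      (Measure.pi fun _ : Fin (m + 1 + r) => paretoMeasure 1 α).map
        (fun x => (pivot x (r + 1), trimmedSum x (r + 1), topSum x (r + 1))) s := by
    rw [← lintegral_indicator_one hs, lintegral_map (measurable_one.indicator hs) hmeas]
  rw [e1] at h1
  have hne : ((m.factorial * r.factorial : ℕ) : ENNReal) ≠ 0 := by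
    have := Nat.mul_pos m.factorial_pos r.factorial_pos
    exact_mod_cast this.ne'
  refine (ENNReal.mul_right_inj hne (ENNReal.natCast_ne_top _)).1 ?_
  rw [h1, Measure.compProd_apply hs, lintegral_pivotLaw]
  have hd : ∀ g : ℝ → ENNReal, ∫⁻ y, g y ∂(paretoMeasure 1 α) =
      ∫⁻ y in Ioi 1, ENNReal.ofReal (α * 1 ^ α * y ^ (-(α + 1))) * g y := by
    intro g
    rw [paretoMeasure_eq_withDensity_restrict,
      lintegral_withDensity_eq_lintegral_mul_non_measurable _ (by fun_prop)
        (ae_of_all _ fun _ => ENNReal.ofReal_lt_top)]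
    rfl
  rw [hd, ← lintegral_const_mul' _ _ (ENNReal.natCast_ne_top _),
    ← lintegral_const_mul' _ _ (ENNReal.natCast_ne_top _)]
  refine setLIntegral_congr_fun measurableSet_Ioi fun y hy => ?_
  have hy : 1 < y := hy
  rw [Kernel.prod_apply, lowerKernel_apply, upperKernel_apply, lowerLaw_of_one_lt hy,
    upperLaw_of_one_lt hy, ← cond_Ioi_eq_paretoMeasure hα hy,
    ← lintegral_indicator_one (measurable_prodMk_left hs), 
    ← mul_assoc _ (ENNReal.ofReal (orderStatPDF (m + 1 + r) (m + 1) α y)),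
    factorial_mul_orderStatPDF hα m r hy]
  simp only [mul_assoc]
  rfl

lemma map_pivot (hα : 0 < α) (m r : ℕ) :
    (Measure.pi fun _ : Fin (m + 1 + r) => paretoMeasure 1 α).map
      (fun x => pivot x (r + 1)) = pivotLaw α m r := by
  have hmeas : Measurable fun x : Fin (m + 1 + r) → ℝ =>
      (pivot x (r + 1), trimmedSum x (r + 1), topSum x (r + 1)) :=
    (measurable_pivot _).prodMk ((measurable_trimmedSum _).prodMk (measurable_topSum _))
  have h := congrArg Measure.fst (map_orderStat hα m r)
  rw [Measure.fst_compProd] at h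
  rw [← h, Measure.fst, Measure.map_map measurable_fst hmeas]
  rfl

lemma isProbabilityMeasure_pivotLaw (hα : 0 < α) (m r : ℕ) :
    IsProbabilityMeasure (pivotLaw α m r) := by
  have := isProbabilityMeasure_paretoMeasure one_pos hα
  rw [← map_pivot hα]
  exact Measure.isProbabilityMeasure_map (measurable_pivot _).aemeasurable

/-- Conditional distributions are determined up to null sets of the pivot law. Its density is
positive on `(1, ∞)`, so these are Lebesgue null there. -/
lemma ae_of_ae_pivotLaw (hα : 0 < α) {m r : ℕ} {p : ℝ → Prop}
    (h : ∀ᵐ y ∂(pivotLaw α m r), p y) : ∀ᵐ y ∂(volume.restrict (Ioi (1 : ℝ))), p y := by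
  refine withDensity_absolutelyContinuous' (f := fun y =>
    ENNReal.ofReal (orderStatPDF (m + 1 + r) (m + 1) α y))
    (measurable_orderStatPDF _ _ _).ennreal_ofReal.aemeasurable ?_ h
  filter_upwards [ae_restrict_mem measurableSet_Ioi] with y hy
  simpa using orderStatPDF_pos hα m r hy

lemma integrableOn_orderStatPDF (hα : 0 < α) (m r : ℕ) :
    IntegrableOn (orderStatPDF (m + 1 + r) (m + 1) α) (Ioi 1) := by
  refine ⟨(measurable_orderStatPDF _ _ _).aestronglyMeasurable, ?_⟩
  have h0 : ∀ᵐ y ∂(volume.restrict (Ioi (1 : ℝ))), 0 ≤ orderStatPDF (m + 1 + r) (m + 1) α y := by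
    filter_upwards [ae_restrict_mem measurableSet_Ioi] with y hy
    exact (orderStatPDF_pos hα m r hy).le
  rw [hasFiniteIntegral_iff_ofReal h0]
  have := isProbabilityMeasure_pivotLaw hα m r
  have h := lintegral_pivotLaw α m r 1
  simp only [Pi.one_apply, lintegral_one, measure_univ, mul_one] at h
  rw [← h]
  exact ENNReal.one_lt_top

end Kernels

/-! ### Conditional laws given the pivot -/

section Sample

variable {α : ℝ} {m r : ℕ} {Ω : Type*} [MeasurableSpace Ω] {P : Measure Ω}
  {X : Ω → Fin (m + 1 + r) → ℝ}

lemma map_pivot_sample (hα : 0 < α) (hX : AEMeasurable X P)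
    (hlaw : P.map X = Measure.pi fun _ => paretoMeasure 1 α) :
    P.map (fun ω => pivot (X ω) (r + 1)) = pivotLaw α m r := by
  rw [← map_pivot hα, ← hlaw, AEMeasurable.map_map_of_aemeasurable
    (measurable_pivot _).aemeasurable hX]
  rfl

/-- A general `g` lets one computation serve the trimmed sum, the top sum, their pair and the whole
sum; `Kernel.id` carries the pivot along, since `g` may depend on it. -/
lemma map_prodMk_sample (hα : 0 < α) (hX : AEMeasurable X P)
    (hlaw : P.map X = Measure.pi fun _ => paretoMeasure 1 α) {β : Type*} [MeasurableSpace β]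
    {g : ℝ × ℝ × ℝ → β} (hg : Measurable g) :
    P.map (fun ω => (pivot (X ω) (r + 1),
      g (pivot (X ω) (r + 1), trimmedSum (X ω) (r + 1), topSum (X ω) (r + 1)))) =
    pivotLaw α m r ⊗ₘ ((Kernel.id ×ₖ (lowerKernel hα m ×ₖ upperKernel hα r)).map g) := by
  have hmeas : Measurable fun x : Fin (m + 1 + r) → ℝ =>
      (pivot x (r + 1), trimmedSum x (r + 1), topSum x (r + 1)) :=
    (measurable_pivot _).prodMk ((measurable_trimmedSum _).prodMk (measurable_topSum _))
  have hpair : Measurable fun p : ℝ × ℝ × ℝ => (p.1, g p) := measurable_fst.prodMk hg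
  have e : P.map (fun ω => (pivot (X ω) (r + 1),
      g (pivot (X ω) (r + 1), trimmedSum (X ω) (r + 1), topSum (X ω) (r + 1)))) =
      (pivotLaw α m r ⊗ₘ (lowerKernel hα m ×ₖ upperKernel hα r)).map fun p => (p.1, g p) := by
    rw [← map_orderStat hα, ← hlaw, Measure.map_map hpair hmeas,
      AEMeasurable.map_map_of_aemeasurable (hpair.comp hmeas).aemeasurable hX]
    rfl
  rw [e]
  ext s hs
  have : IsMarkovKernel ((Kernel.id ×ₖ (lowerKernel hα m ×ₖ upperKernel hα r)).map g) :=
    Kernel.IsMarkovKernel.map _ hg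
  rw [Measure.map_apply hpair hs, Measure.compProd_apply (hpair hs), Measure.compProd_apply hs]
  refine lintegral_congr fun y => ?_
  rw [Kernel.map_apply' _ hg _ (measurable_prodMk_left hs), Kernel.prod_apply Kernel.id,
    Kernel.id_apply,
    Measure.dirac_prod, Measure.map_apply measurable_prodMk_left
      (hg (measurable_prodMk_left hs))]
  rfl

variable [IsProbabilityMeasure P]

lemma condDistrib_sample (hα : 0 < α) (hX : AEMeasurable X P)
    (hlaw : P.map X = Measure.pi fun _ => paretoMeasure 1 α) {β : Type*} [MeasurableSpace β]
    [StandardBorelSpace β] [Nonempty β] {g : ℝ × ℝ × ℝ → β} (hg : Measurable g) :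
    ∀ᵐ y ∂(volume.restrict (Ioi (1 : ℝ))),
      condDistrib (fun ω => g (pivot (X ω) (r + 1), trimmedSum (X ω) (r + 1),
        topSum (X ω) (r + 1))) (fun ω => pivot (X ω) (r + 1)) P y =
      ((lowerKernel hα m y).prod (upperKernel hα r y)).map fun q => g (y, q) := by
  have hmeas : Measurable fun x : Fin (m + 1 + r) → ℝ =>
      (pivot x (r + 1), trimmedSum x (r + 1), topSum x (r + 1)) :=
    (measurable_pivot _).prodMk ((measurable_trimmedSum _).prodMk (measurable_topSum _))
  have : IsMarkovKernel ((Kernel.id ×ₖ (lowerKernel hα m ×ₖ upperKernel hα r)).map g) :=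
    Kernel.IsMarkovKernel.map _ hg
  have h := condDistrib_ae_eq_of_measure_eq_compProd (μ := P)
    (fun ω => pivot (X ω) (r + 1))
    (Y := fun ω => g (pivot (X ω) (r + 1), trimmedSum (X ω) (r + 1), topSum (X ω) (r + 1)))
    ((hg.comp hmeas).comp_aemeasurable hX)
    (κ := (Kernel.id ×ₖ (lowerKernel hα m ×ₖ upperKernel hα r)).map g)
    (by rw [map_prodMk_sample hα hX hlaw hg, map_pivot_sample hα hX hlaw])
  rw [map_pivot_sample hα hX hlaw] at h
  filter_upwards [ae_of_ae_pivotLaw hα h] with y hy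
  rw [hy, Kernel.map_apply _ hg, Kernel.prod_apply, Kernel.id_apply, Measure.dirac_prod,
    Measure.map_map hg measurable_prodMk_left, Kernel.prod_apply]
  rfl

lemma condDistrib_trimmedSum_topSum (hα : 0 < α) (hX : AEMeasurable X P)
    (hlaw : P.map X = Measure.pi fun _ => paretoMeasure 1 α) :
    ∀ᵐ y ∂(volume.restrict (Ioi (1 : ℝ))),
      condDistrib (fun ω => (trimmedSum (X ω) (r + 1), topSum (X ω) (r + 1)))
        (fun ω => pivot (X ω) (r + 1)) P y =
      (lowerKernel hα m y).prod (upperKernel hα r y) := by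
  filter_upwards [condDistrib_sample hα hX hlaw (g := fun p => p.2) measurable_snd] with y hy
  rw [hy]
  exact Measure.map_id

lemma condDistrib_trimmedSum (hα : 0 < α) (hX : AEMeasurable X P)
    (hlaw : P.map X = Measure.pi fun _ => paretoMeasure 1 α) :
    ∀ᵐ y ∂(volume.restrict (Ioi (1 : ℝ))),
      condDistrib (fun ω => trimmedSum (X ω) (r + 1))
        (fun ω => pivot (X ω) (r + 1)) P y = lowerKernel hα m y := by
  filter_upwards [condDistrib_sample hα hX hlaw (g := fun p => p.2.1) (by fun_prop)] with y hy
  rw [hy]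
  exact measurePreserving_fst.map_eq

lemma condDistrib_topSum (hα : 0 < α) (hX : AEMeasurable X P)
    (hlaw : P.map X = Measure.pi fun _ => paretoMeasure 1 α) :
    ∀ᵐ y ∂(volume.restrict (Ioi (1 : ℝ))),
      condDistrib (fun ω => topSum (X ω) (r + 1))
        (fun ω => pivot (X ω) (r + 1)) P y = upperKernel hα r y := by
  filter_upwards [condDistrib_sample hα hX hlaw (g := fun p => p.2.2) (by fun_prop)] with y hy
  rw [hy]
  exact measurePreserving_snd.map_eq

lemma sum_sample_eq (hm : 0 < m) (x : Fin (m + 1 + r) → ℝ) :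
    ∑ i, x i = pivot x (r + 1) + (trimmedSum x (r + 1) + topSum x (r + 1)) := by
  rw [sum_eq_trimmedSum_add (Nat.succ_pos r) (by omega)]
  ring

lemma conv_map_const_add (μ ν : Measure ℝ) [IsProbabilityMeasure μ] [IsProbabilityMeasure ν]
    (y : ℝ) : (μ.prod ν).map (fun q => y + (q.1 + q.2)) = (μ ∗ ν).map (fun t => y + t) := by
  rw [Measure.conv, Measure.map_map (by fun_prop) (by fun_prop)]
  rfl

lemma cdf_map_const_add (μ : Measure ℝ) [IsProbabilityMeasure μ] (x y : ℝ) :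
    cdf (μ.map fun t => y + t) x = μ.real (Iic (x - y)) := by
  have : IsProbabilityMeasure (μ.map fun t => y + t) :=
    Measure.isProbabilityMeasure_map (by fun_prop)
  rw [cdf_eq_real, map_measureReal_apply (by fun_prop) measurableSet_Iic]
  congr 1
  ext t
  simp only [mem_preimage, mem_Iic]
  constructor <;> intro h <;> linarith

lemma condDistrib_sum (hα : 0 < α) (hm : 0 < m) (hX : AEMeasurable X P)
    (hlaw : P.map X = Measure.pi fun _ => paretoMeasure 1 α) :
    ∀ᵐ y ∂(volume.restrict (Ioi (1 : ℝ))), ∀ x,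
      cdf (condDistrib (fun ω => ∑ i, X ω i) (fun ω => pivot (X ω) (r + 1)) P y) x =
        (lowerKernel hα m y ∗ upperKernel hα r y).real (Iic (x - y)) := by
  filter_upwards [condDistrib_sample hα hX hlaw (g := fun p => p.1 + (p.2.1 + p.2.2))
    (by fun_prop)] with y hy x
  simp only [sum_sample_eq hm, hy]
  rw [conv_map_const_add, cdf_map_const_add]

lemma measurable_conv_kernel (κ η : Kernel ℝ ℝ) [IsMarkovKernel κ] [IsMarkovKernel η]
    {t : Set (ℝ × ℝ)} (ht : MeasurableSet t) :
    Measurable fun y => (κ y ∗ η y).real (Prod.mk y ⁻¹' t) := by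
  have h : ∀ y, κ y ∗ η y = ((κ ×ₖ η).map fun q => q.1 + q.2) y := by
    intro y
    rw [Kernel.map_apply _ (by fun_prop), Kernel.prod_apply, Measure.conv]
  simp only [h, measureReal_def]
  have : IsMarkovKernel ((κ ×ₖ η).map fun q : ℝ × ℝ => q.1 + q.2) :=
    Kernel.IsMarkovKernel.map _ (by fun_prop)
  exact (Kernel.measurable_kernel_prodMk_left ht).ennreal_toReal

lemma integral_pivotLaw (hα : 0 < α) (g : ℝ → ℝ) :
    ∫ y, g y ∂(pivotLaw α m r) =
      ∫ y in Ioi 1, orderStatPDF (m + 1 + r) (m + 1) α y * g y := by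
  rw [pivotLaw, integral_withDensity_eq_integral_toReal_smul
    (measurable_orderStatPDF _ _ _).ennreal_ofReal (ae_of_all _ fun _ => ENNReal.ofReal_lt_top)]
  refine setIntegral_congr_fun measurableSet_Ioi fun y hy => ?_
  simp only [smul_eq_mul]
  rw [ENNReal.toReal_ofReal (orderStatPDF_pos hα m r hy).le]

lemma cdf_sum (hα : 0 < α) (hm : 0 < m) (hX : AEMeasurable X P)
    (hlaw : P.map X = Measure.pi fun _ => paretoMeasure 1 α) (x : ℝ) :
    cdf (P.map fun ω => ∑ i, X ω i) x = ∫ y in Ioi 1, orderStatPDF (m + 1 + r) (m + 1) α y *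
      (lowerKernel hα m y ∗ upperKernel hα r y).real (Iic (x - y)) := by
  have hsum : AEMeasurable (fun ω => ∑ i, X ω i) P :=
    (Finset.measurable_sum Finset.univ fun i _ => measurable_pi_apply i).comp_aemeasurable hX
  have : IsProbabilityMeasure (P.map fun ω => ∑ i, X ω i) := Measure.isProbabilityMeasure_map hsum
  have hg : Measurable fun p : ℝ × ℝ × ℝ => p.1 + (p.2.1 + p.2.2) := by fun_prop
  have h := map_prodMk_sample hα hX hlaw hg
  have hmeas : AEMeasurable (fun ω => (pivot (X ω) (r + 1),
      pivot (X ω) (r + 1) + (trimmedSum (X ω) (r + 1) + topSum (X ω) (r + 1)))) P :=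
    ((measurable_pivot _).prodMk ((measurable_pivot _).add
      ((measurable_trimmedSum _).add (measurable_topSum _)))).comp_aemeasurable hX
  have : IsMarkovKernel ((Kernel.id ×ₖ (lowerKernel hα m ×ₖ upperKernel hα r)).map
      fun p : ℝ × ℝ × ℝ => p.1 + (p.2.1 + p.2.2)) := Kernel.IsMarkovKernel.map _ hg
  have e : (P.map fun ω => ∑ i, X ω i) (Iic x) =
      ∫⁻ y, (lowerKernel hα m y ∗ upperKernel hα r y) (Iic (x - y)) ∂(pivotLaw α m r) := by
    have e1 : (P.map fun ω => ∑ i, X ω i) (Iic x) = (P.map fun ω => (pivot (X ω) (r + 1),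
      pivot (X ω) (r + 1) + (trimmedSum (X ω) (r + 1) + topSum (X ω) (r + 1)))) (univ ×ˢ Iic x) := by
      rw [Measure.map_apply_of_aemeasurable hsum measurableSet_Iic,
        Measure.map_apply_of_aemeasurable hmeas (MeasurableSet.univ.prod measurableSet_Iic)]
      congr 1
      ext ω
      simp [sum_sample_eq hm]
    rw [e1, h, Measure.compProd_apply_prod MeasurableSet.univ measurableSet_Iic, setLIntegral_univ]
    refine lintegral_congr fun y => ?_
    rw [Kernel.map_apply' _ hg _ measurableSet_Iic, Kernel.prod_apply, Kernel.id_apply,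
      Measure.dirac_prod, Measure.map_apply measurable_prodMk_left (hg measurableSet_Iic),
      Kernel.prod_apply, Measure.conv, Measure.map_apply (by fun_prop) measurableSet_Iic]
    congr 1
    ext q
    simp only [mem_preimage, mem_Iic]
    constructor <;> intro h <;> linarith
  have hset : MeasurableSet {p : ℝ × ℝ | p.2 ≤ x - p.1} :=
    measurableSet_le (by fun_prop) (by fun_prop)
  have hm' := measurable_conv_kernel (lowerKernel hα m) (upperKernel hα r) hset
  rw [cdf_eq_real, measureReal_def, e, ← integral_pivotLaw hα]
  simp only [measureReal_def]
  rw [integral_toReal]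
  · have h2 := (hm'.ennreal_ofReal).aemeasurable (μ := pivotLaw α m r)
    simp only [measureReal_def, ENNReal.ofReal_toReal (measure_ne_top _ _)] at h2
    exact h2
  · exact ae_of_all _ fun y => measure_lt_top _ _

end Sample

/-! ### Comparison of convolutions -/

lemma conv_real_Iic (A ρ : Measure ℝ) [IsProbabilityMeasure A] [IsProbabilityMeasure ρ] (s : ℝ) :
    (A ∗ ρ).real (Iic s) = ∫ u, cdf A (s - u) ∂ρ := by
  have hm : MeasurableSet ((fun p : ℝ × ℝ => p.1 + p.2) ⁻¹' Iic s) :=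
    (measurable_fst.add measurable_snd) measurableSet_Iic
  rw [measureReal_def, Measure.conv, Measure.map_apply (by fun_prop) measurableSet_Iic,
    Measure.prod_apply_symm hm]
  have : ∀ u, A ((fun x => (x, u)) ⁻¹' ((fun p : ℝ × ℝ => p.1 + p.2) ⁻¹' Iic s)) =
      ENNReal.ofReal (cdf A (s - u)) := by
    intro u
    rw [ofReal_cdf]
    congr 1
    ext x
    simp only [mem_preimage, mem_Iic]
    constructor <;> intro h <;> linarith
  simp only [this]
  rw [integral_eq_lintegral_of_nonneg_ae (ae_of_all _ fun u => cdf_nonneg A _)]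
  exact ((monotone_cdf A).measurable.comp (measurable_const.sub measurable_id)).aestronglyMeasurable

lemma integrable_cdf_sub (A ρ : Measure ℝ) [IsProbabilityMeasure ρ] (s : ℝ) :
    Integrable (fun u => cdf A (s - u)) ρ :=
  Integrable.of_bound ((monotone_cdf A).measurable.comp
    (measurable_const.sub measurable_id)).aestronglyMeasurable 1 (ae_of_all _ fun u => by
      rw [Real.norm_of_nonneg (cdf_nonneg A _)]; exact cdf_le_one A _)

/-- Convolution with `ρ` averages translates of the two cdfs with the same weights. -/
lemma abs_conv_real_Iic_sub_le (A B ρ : Measure ℝ) [IsProbabilityMeasure A]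
    [IsProbabilityMeasure B] [IsProbabilityMeasure ρ] (s : ℝ) :
    |(A ∗ ρ).real (Iic s) - (B ∗ ρ).real (Iic s)| ≤ kolmogorovDist A B := by
  rw [conv_real_Iic, conv_real_Iic, ← integral_sub (integrable_cdf_sub A ρ s)
    (integrable_cdf_sub B ρ s)]
  refine (norm_integral_le_of_norm_le_const (μ := ρ) (f := fun u => cdf A (s - u) - cdf B (s - u))
    (ae_of_all _ fun u => abs_cdf_sub_le A B (s - u))).trans ?_
  simp

lemma conv_real_Iic_zero {A ρ : Measure ℝ} [IsProbabilityMeasure A] [IsProbabilityMeasure ρ]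
    (hA : ∀ᵐ x ∂A, 0 < x) (hR : ∀ᵐ x ∂ρ, 0 ≤ x) {s : ℝ} (hs : s ≤ 0) :
    (A ∗ ρ).real (Iic s) = 0 := by
  rw [conv_real_Iic]
  refine integral_eq_zero_of_ae ?_
  filter_upwards [hR] with u hu
  have h0 : A (Iic (s - u)) = 0 := by
    refine measure_mono_null ?_ hA
    intro x hx
    simp only [mem_Iic] at hx
    simp only [mem_compl_iff, mem_ofPred_eq, not_lt]
    linarith
  simp [cdf_eq_real, measureReal_def, h0]

/-- The origin of the factor 2. The mass of `B ∗ ρ` on `(-∞, 0]` is missing from the integral over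
`Ioc 0 s`; as `A ∗ ρ` has none there, this mass is itself at most one Kolmogorov distance. -/
lemma abs_conv_real_Iic_sub_Ioc_le {A B ρ : Measure ℝ} [IsProbabilityMeasure A]
    [IsProbabilityMeasure B] [IsProbabilityMeasure ρ] (hA : ∀ᵐ x ∂A, 0 < x)
    (hR : ∀ᵐ x ∂ρ, 0 ≤ x) {s : ℝ} (hs : 0 ≤ s) :
    |(A ∗ ρ).real (Iic s) - (B ∗ ρ).real (Ioc 0 s)| ≤ 2 * kolmogorovDist A B := by
  have h1 : (B ∗ ρ).real (Ioc 0 s) = (B ∗ ρ).real (Iic s) - (B ∗ ρ).real (Iic 0) := by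
    rw [← measureReal_sdiff (Iic_subset_Iic.2 hs) measurableSet_Iic]
    congr 1
    ext x
    simp [and_comm]
  have h2 := abs_le.1 (abs_conv_real_Iic_sub_le A B ρ s)
  have h3 := abs_le.1 (abs_conv_real_Iic_sub_le A B ρ 0)
  rw [conv_real_Iic_zero hA hR le_rfl] at h3
  rw [h1, abs_le]
  constructor <;> linarith

/-! ### Signs of the conditional sums -/

section Positivity

variable {α : ℝ}

lemma ae_pos_lowerKernel (hα : 0 < α) {m : ℕ} (hm : 0 < m) {y : ℝ} (hy : 1 < y) :
    ∀ᵐ x ∂(lowerKernel hα m y), 0 < x := by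
  have := isProbabilityMeasure_below hα hy
  rw [lowerKernel_apply, lowerLaw_of_one_lt hy, sumLaw,
    ae_map_iff (by fun_prop) measurableSet_Ioi]
  have h : ∀ i : Fin m, ∀ᵐ x ∂(Measure.pi fun _ : Fin m => below α y), 1 < x i := fun i =>
    (measurePreserving_eval (fun _ : Fin m => below α y) i).quasiMeasurePreserving.ae
      ((ae_below α y).mono fun x hx => hx.1)
  filter_upwards [ae_all_iff.2 h] with x hx
  exact Finset.sum_pos (fun i _ => one_pos.trans (hx i)) ⟨⟨0, hm⟩, Finset.mem_univ _⟩

lemma ae_nonneg_upperKernel (hα : 0 < α) (r : ℕ) {y : ℝ} (hy : 1 < y) :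
    ∀ᵐ x ∂(upperKernel hα r y), 0 ≤ x := by
  have := isProbabilityMeasure_paretoMeasure (one_pos.trans hy) hα
  rw [upperKernel_apply, upperLaw_of_one_lt hy, sumLaw,
    ae_map_iff (by fun_prop) measurableSet_Ici]
  have h0 : ∀ᵐ x ∂(paretoMeasure y α), 0 ≤ x := by
    rw [paretoMeasure_eq_withDensity_restrict]
    refine withDensity_absolutelyContinuous _ _ ?_
    filter_upwards [ae_restrict_mem measurableSet_Ioi] with x hx
    exact (one_pos.trans (hy.trans hx)).le
  have h : ∀ i : Fin r, ∀ᵐ x ∂(Measure.pi fun _ : Fin r => paretoMeasure y α), 0 ≤ x i := fun i =>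
    (measurePreserving_eval (fun _ : Fin r => paretoMeasure y α) i).quasiMeasurePreserving.ae h0
  filter_upwards [ae_all_iff.2 h] with x hx
  exact Finset.sum_nonneg fun i _ => hx i

end Positivity

/-! ### The normal mixture -/

lemma measurable_condMean (n k : ℕ) (α : ℝ) : Measurable (condMean n k α) := by
  unfold condMean
  by_cases h : α = 1
  · simp only [if_pos h]; fun_prop
  · simp only [if_neg h]; fun_prop

lemma measurable_condVar (n k : ℕ) (α : ℝ) : Measurable (condVar n k α) := by
  unfold condVar
  by_cases h : α = 1
  · simp only [if_pos h]; fun_prop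
  · by_cases h2 : α = 2
    · simp only [if_neg h, if_pos h2]; fun_prop
    · simp only [if_neg h, if_neg h2]; fun_prop

/-- The normal approximation of the trimmed sum, as a kernel. -/
def normalKernel (n k : ℕ) (α : ℝ) : Kernel ℝ ℝ where
  toFun y := condNormal n k α y
  measurable' := measurable_gaussianReal.comp
    ((measurable_condMean n k α).prodMk (measurable_condVar n k α).real_toNNReal)

lemma normalKernel_apply (n k : ℕ) (α y : ℝ) : normalKernel n k α y = condNormal n k α y := rfl

instance (n k : ℕ) (α y : ℝ) : IsProbabilityMeasure (condNormal n k α y) := by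
  rw [condNormal]; infer_instance

instance (n k : ℕ) (α : ℝ) : IsMarkovKernel (normalKernel n k α) where
  isProbabilityMeasure y := by rw [normalKernel_apply]; infer_instance

/-- By right continuity of cdfs. A countable supremum makes the distance measurable in `y`. -/
lemma kolmogorovDist_eq_iSup_rat (μ ν : Measure ℝ) :
    kolmogorovDist μ ν = ⨆ q : ℚ, |cdf μ q - cdf ν q| := by
  have hb : BddAbove (range fun q : ℚ => |cdf μ q - cdf ν q|) :=
    (bddAbove_kolmogorovDist μ ν).mono (by rintro _ ⟨q, rfl⟩; exact ⟨q, rfl⟩)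
  apply le_antisymm
  · refine kolmogorovDist_le fun t => ?_
    have h1 : Tendsto (fun s => |cdf μ s - cdf ν s|) (𝓝[>] t) (𝓝 |cdf μ t - cdf ν t|) :=
      ((((cdf μ).right_continuous t).tendsto.mono_left (nhdsWithin_mono _ Ioi_subset_Ici_self)).sub
        (((cdf ν).right_continuous t).tendsto.mono_left
          (nhdsWithin_mono _ Ioi_subset_Ici_self))).abs
    refine le_of_tendsto_of_frequently h1 ?_
    rw [Filter.Frequently]
    intro hcon
    obtain ⟨u, hu, hsub⟩ := mem_nhdsGT_iff_exists_Ioo_subset.1 hcon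
    obtain ⟨q, hq1, hq2⟩ := exists_rat_btwn (mem_Ioi.1 hu)
    exact hsub ⟨hq1, hq2⟩ (le_ciSup hb q)
  · exact ciSup_le fun q => abs_cdf_sub_le μ ν q

lemma measurable_kolmogorovDist (κ η : Kernel ℝ ℝ) [IsMarkovKernel κ] [IsMarkovKernel η] :
    Measurable fun y => kolmogorovDist (κ y) (η y) := by
  simp only [kolmogorovDist_eq_iSup_rat, cdf_eq_real, measureReal_def]
  refine Measurable.iSup fun q => ?_
  have h : ∀ (θ : Kernel ℝ ℝ), Measurable fun y => (θ y (Iic (q : ℝ))).toReal := fun θ =>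
    (θ.measurable_coe measurableSet_Iic).ennreal_toReal
  exact continuous_abs.measurable.comp ((h κ).sub (h η))

/-! ### The error bound, and asymptotic normality given the pivot -/

section Bound

variable {α : ℝ} {m r : ℕ}

lemma condVar_pos (hα : 0 < α) (hm : 0 < m) {y : ℝ} (hy : 1 < y) :
    0 < condVar (m + 1 + r) (r + 1) α y := by
  have := condVar_one_pos hα hy
  have hm' : (0 : ℝ) < m := by exact_mod_cast hm
  rw [condVar_eq_mul]
  have e : ((m + 1 + r : ℕ) : ℝ) - (r + 1 : ℕ) = m := by push_cast; ring
  rw [e]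
  positivity

lemma condNormal_eq (m r : ℕ) (α y : ℝ) : condNormal (m + 1 + r) (r + 1) α y =
    gaussianReal (m * condMean 1 0 α y) (m * condVar 1 0 α y).toNNReal := by
  have e : ((m + 1 + r : ℕ) : ℝ) - (r + 1 : ℕ) = m := by push_cast; ring
  rw [condNormal, condMean_eq_mul, condVar_eq_mul, e]

lemma normexInner_eq_conv (hα : 0 < α) (hm : 0 < m) {y s : ℝ} (hy : 1 < y) (hs : 0 ≤ s) :
    normexInner (m + 1 + r) (r + 1) α y s =
      (normalKernel (m + 1 + r) (r + 1) α y ∗ upperKernel hα r y).real (Ioc 0 s) := by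
  rw [normexInner_eq hα (one_pos.trans hy) (condVar_pos hα hm hy) hs, normalKernel_apply,
    upperKernel_apply, upperLaw_of_one_lt hy]

lemma abs_conv_sub_normexInner_le (hα : 0 < α) (hm : 0 < m) {x y : ℝ} (hy : 1 < y) (hx : y ≤ x) :
    |(lowerKernel hα m y ∗ upperKernel hα r y).real (Iic (x - y)) -
      normexInner (m + 1 + r) (r + 1) α y (x - y)| ≤
      2 * kolmogorovDist (lowerKernel hα m y) (condNormal (m + 1 + r) (r + 1) α y) := by
  rw [normexInner_eq_conv hα hm hy (sub_nonneg.2 hx)]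
  exact abs_conv_real_Iic_sub_Ioc_le (ae_pos_lowerKernel hα hm hy) (ae_nonneg_upperKernel hα r hy)
    (sub_nonneg.2 hx)

lemma normexCDF_eq (m r : ℕ) (α : ℝ) {x : ℝ} (hx : 1 ≤ x) :
    normexCDF (m + 1 + r) (r + 1) α x = ∫ y in (1 : ℝ)..x,
      orderStatPDF (m + 1 + r) (m + 1) α y * normexInner (m + 1 + r) (r + 1) α y (x - y) := by
  rcases r with _ | r
  · rw [normexCDF, if_pos (by rfl), ← intervalIntegral.integral_const_mul]
    refine intervalIntegral.integral_congr fun y hy => ?_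
    rw [uIcc_of_le hx] at hy
    have hy0 : 0 < y := one_pos.trans_le hy.1
    have e : y ^ (-(α * (((0 : ℕ) : ℝ) + 1)) - 1) = (y ^ (1 + α))⁻¹ := by
      rw [← Real.rpow_neg hy0.le]; congr 1; push_cast; ring
    have e2 : (((m + 1 + 0).factorial : ℕ) : ℝ) / (m.factorial * Nat.factorial 0) = m + 1 := by
      have : (m.factorial : ℝ) ≠ 0 := by exact_mod_cast m.factorial_ne_zero
      rw [add_zero, Nat.factorial_succ]
      push_cast
      field_simp
      simp
    simp only [orderStatPDF_eq]
    rw [e, e2]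
    simp only [add_zero, Nat.add_sub_cancel]
    push_cast
    ring
  · have h : m + 1 + (r + 1) - (r + 1 + 1) + 1 = m + 1 := by omega
    rw [normexCDF, if_neg (by omega), h]

lemma intervalIntegrable_orderStatPDF_mul (hα : 0 < α) {x : ℝ} (hx : 1 ≤ x) {g : ℝ → ℝ}
    (hg : Measurable g) (h1 : ∀ y, |g y| ≤ 1) :
    IntervalIntegrable (fun y => orderStatPDF (m + 1 + r) (m + 1) α y * g y) volume 1 x := by
  rw [intervalIntegrable_iff_integrableOn_Ioc_of_le hx]
  exact ((integrableOn_orderStatPDF hα m r).mono_set Ioc_subset_Ioi_self).mul_bdd (c := 1)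
    hg.aestronglyMeasurable (ae_of_all _ h1)

lemma abs_kolmogorovDist_le_one (μ ν : Measure ℝ) : |kolmogorovDist μ ν| ≤ 1 := by
  rw [abs_of_nonneg (kolmogorovDist_nonneg μ ν)]
  exact kolmogorovDist_le_one μ ν

lemma abs_measureReal_le_one (μ : Measure ℝ) [IsProbabilityMeasure μ] (s : Set ℝ) :
    |μ.real s| ≤ 1 := by
  rw [abs_of_nonneg measureReal_nonneg]
  exact measureReal_le_one

variable {Ω : Type*} [MeasurableSpace Ω] {P : Measure Ω}
  [IsProbabilityMeasure P] {X : Ω → Fin (m + 1 + r) → ℝ}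

theorem abs_cdf_sub_normexCDF_le (hα : 0 < α) (hm : 0 < m) (hX : AEMeasurable X P)
    (hlaw : P.map X = Measure.pi fun _ => paretoMeasure 1 α) {x : ℝ} (hx : 1 ≤ x) :
    |cdf (P.map fun ω => ∑ i, X ω i) x - normexCDF (m + 1 + r) (r + 1) α x| ≤
      2 * ∫ y in (1 : ℝ)..x, orderStatPDF (m + 1 + r) (m + 1) α y *
        kolmogorovDist (lowerKernel hα m y) (condNormal (m + 1 + r) (r + 1) α y) := by
  set f := orderStatPDF (m + 1 + r) (m + 1) α with hf
  have hset1 : MeasurableSet {p : ℝ × ℝ | p.2 ≤ x - p.1} :=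
    measurableSet_le (by fun_prop) (by fun_prop)
  have hset2 : MeasurableSet {p : ℝ × ℝ | 0 < p.2 ∧ p.2 ≤ x - p.1} :=
    (measurableSet_lt measurable_const measurable_snd).inter hset1
  have hA : Measurable fun y => (lowerKernel hα m y ∗ upperKernel hα r y).real (Iic (x - y)) :=
    measurable_conv_kernel _ _ hset1
  have hB : Measurable fun y => (normalKernel (m + 1 + r) (r + 1) α y ∗
      upperKernel hα r y).real (Ioc 0 (x - y)) := measurable_conv_kernel _ _ hset2
  have e1 : cdf (P.map fun ω => ∑ i, X ω i) x = ∫ y in (1 : ℝ)..x, f y *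
      (lowerKernel hα m y ∗ upperKernel hα r y).real (Iic (x - y)) := by
    -- Pivots beyond `x` contribute nothing, since the other entries are positive and the sum
    -- exceeds the pivot.
    rw [cdf_sum hα hm hX hlaw, intervalIntegral.integral_of_le hx]
    refine (setIntegral_eq_of_subset_of_forall_sdiff_eq_zero measurableSet_Ioi
      (Ioc_subset_Ioi_self : Ioc 1 x ⊆ Ioi 1) ?_)
    rintro y ⟨hy1, hy2⟩
    have hy1 : 1 < y := hy1
    have hxy : x < y := by
      by_contra hc
      exact hy2 ⟨hy1, not_lt.1 hc⟩
    rw [conv_real_Iic_zero (ae_pos_lowerKernel hα hm hy1) (ae_nonneg_upperKernel hα r hy1)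
      (by linarith), mul_zero]
  have e2 : normexCDF (m + 1 + r) (r + 1) α x = ∫ y in (1 : ℝ)..x, f y *
      (normalKernel (m + 1 + r) (r + 1) α y ∗ upperKernel hα r y).real (Ioc 0 (x - y)) := by
    rw [normexCDF_eq m r α hx]
    refine intervalIntegral.integral_congr_ae (ae_of_all _ fun y hy => ?_)
    rw [uIoc_of_le hx] at hy
    rw [normexInner_eq_conv hα hm hy.1 (sub_nonneg.2 hy.2)]
  have iA := intervalIntegrable_orderStatPDF_mul (m := m) (r := r) hα hx hA
    fun y => abs_measureReal_le_one _ _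
  have iB := intervalIntegrable_orderStatPDF_mul (m := m) (r := r) hα hx hB
    fun y => abs_measureReal_le_one _ _
  have iK := intervalIntegrable_orderStatPDF_mul (m := m) (r := r) hα hx
    (measurable_kolmogorovDist (lowerKernel hα m) (normalKernel (m + 1 + r) (r + 1) α))
    fun y => abs_kolmogorovDist_le_one _ _
  rw [e1, e2, ← intervalIntegral.integral_sub iA iB, ← intervalIntegral.integral_const_mul,
    ← Real.norm_eq_abs]
  refine intervalIntegral.norm_integral_le_of_norm_le (μ := volume) hx (ae_of_all _ fun y hy => ?_)
    (iK.const_mul 2)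
  have hfy : 0 < f y := orderStatPDF_pos hα m r hy.1
  have hb := abs_conv_sub_normexInner_le (r := r) hα hm hy.1 hy.2
  rw [normexInner_eq_conv hα hm hy.1 (sub_nonneg.2 hy.2)] at hb
  rw [← mul_sub, Real.norm_eq_abs, abs_mul, abs_of_pos hfy]
  calc _ ≤ f y * (2 * kolmogorovDist (lowerKernel hα m y)
        (condNormal (m + 1 + r) (r + 1) α y)) := by gcongr
    _ = _ := by rw [← normalKernel_apply]; ring

/-- The right-hand side does not depend on `x`, which makes the final convergence uniform. -/
lemma intervalIntegral_le_integral_pivotLaw (hα : 0 < α) {x : ℝ} (hx : 1 ≤ x) :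
    ∫ y in (1 : ℝ)..x, orderStatPDF (m + 1 + r) (m + 1) α y *
        kolmogorovDist (lowerKernel hα m y) (condNormal (m + 1 + r) (r + 1) α y) ≤
      ∫ y, kolmogorovDist (lowerKernel hα m y) (condNormal (m + 1 + r) (r + 1) α y)
        ∂(pivotLaw α m r) := by
  rw [integral_pivotLaw hα, intervalIntegral.integral_of_le hx]
  refine setIntegral_mono_set (μ := volume) ?_ ?_ (Eventually.of_forall Ioc_subset_Ioi_self)
  · exact (integrableOn_orderStatPDF hα m r).mul_bdd (c := 1)
      (measurable_kolmogorovDist (lowerKernel hα m)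
        (normalKernel (m + 1 + r) (r + 1) α)).aestronglyMeasurable
      (ae_of_all _ fun y => abs_kolmogorovDist_le_one _ _)
  · filter_upwards [ae_restrict_mem measurableSet_Ioi] with y hy
    exact mul_nonneg (orderStatPDF_pos hα m r hy).le (kolmogorovDist_nonneg _ _)

/-- The trimmed sum is asymptotically normal given the pivot, uniformly over pivots that are small
compared to the conditional standard deviation. -/
lemma exists_kolmogorovDist_lowerKernel_le (hα : 0 < α) {ε : ℝ} (hε : 0 < ε) :
    ∃ δ > 0, ∀ (m r : ℕ) (y : ℝ), 1 < y → y ≤ δ * √(m * condVar 1 0 α y) →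
      kolmogorovDist (lowerKernel hα m y) (condNormal (m + 1 + r) (r + 1) α y) ≤ ε := by
  obtain ⟨δ, hδ, h⟩ := exists_kolmogorovDist_sumLaw_le hε
  refine ⟨δ, hδ, fun m r y hy hb => ?_⟩
  have := isProbabilityMeasure_below hα hy
  have hmem := memLp_below hα hy
  have hmean := integral_id_below hα hy
  have hvar := variance_below hα hy
  rw [variance_eq_integral (by fun_prop)] at hvar
  simp only [id] at hvar
  rw [hmean] at hvar
  rw [condNormal_eq, lowerKernel_apply, lowerLaw_of_one_lt hy]
  -- The bound on the centered entries is `y`, because both the entries and their mean lie in `[0,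
  -- y]`.
  refine h m (below α y) y _ _ ?_ hmean hvar (condVar_one_pos hα hy) hb
  have hbd : ∀ᵐ x ∂(below α y), 0 ≤ x ∧ x ≤ y :=
    (ae_below α y).mono fun x hx => ⟨by linarith [hx.1], hx.2.le⟩
  have hint : Integrable (fun x : ℝ => x) (below α y) := hmem.integrable (by norm_num)
  have h0 : 0 ≤ condMean 1 0 α y := by
    rw [← hmean]
    exact integral_nonneg_of_ae (hbd.mono fun x hx => hx.1)
  have h1 : condMean 1 0 α y ≤ y := by
    rw [← hmean]
    have := integral_mono_ae hint (integrable_const y) (hbd.mono fun x hx => hx.2)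
    simpa using this
  filter_upwards [hbd] with x hx
  rw [abs_le]
  constructor <;> linarith [hx.1, hx.2]

lemma tendsto_kolmogorovDist_lowerKernel (hα : 0 < α) (r : ℕ) {y : ℝ} (hy : 1 < y) :
    Tendsto (fun m : ℕ => kolmogorovDist (lowerKernel hα m y)
      (condNormal (m + 1 + r) (r + 1) α y)) atTop (𝓝 0) := by
  rw [Metric.tendsto_atTop']
  intro ε hε
  obtain ⟨δ, hδ, h⟩ := exists_kolmogorovDist_lowerKernel_le hα (half_pos hε)
  have hv := condVar_one_pos hα hy
  have hlim : Tendsto (fun m : ℕ => δ * √(m * condVar 1 0 α y)) atTop atTop :=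
    (Real.tendsto_sqrt_atTop.comp
      (tendsto_natCast_atTop_atTop.atTop_mul_const hv)).const_mul_atTop hδ
  obtain ⟨M, hM⟩ := eventually_atTop.1 (hlim.eventually_ge_atTop y)
  refine ⟨M, fun m hm => ?_⟩
  rw [Real.dist_eq, sub_zero, abs_of_nonneg (kolmogorovDist_nonneg _ _)]
  exact (h m r y hy (hM m hm.le)).trans_lt (half_lt_self hε)

end Bound

/-! ### Tails of the pivot -/

section Tails

variable {α : ℝ}

lemma factorial_div_le_pow (m r : ℕ) :
    ((m + 1 + r).factorial : ℝ) / (m.factorial * r.factorial) ≤ ((m + 1 + r : ℕ) : ℝ) ^ (r + 1) := by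
  have h1 := Nat.factorial_mul_descFactorial (show r + 1 ≤ m + 1 + r by omega)
  rw [show m + 1 + r - (r + 1) = m by omega] at h1
  have h2 := Nat.descFactorial_le_pow (m + 1 + r) (r + 1)
  have hm : (0 : ℝ) < m.factorial := by exact_mod_cast m.factorial_pos
  have hr : (1 : ℝ) ≤ r.factorial := by exact_mod_cast r.factorial_pos
  rw [← h1]
  push_cast
  rw [mul_div_mul_left _ _ hm.ne']
  refine (div_le_self (by positivity) hr).trans ?_
  exact_mod_cast h2

/-- Bound `1 - y ^ (-α)` by one in the density and integrate the remaining power. -/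
lemma pivotLaw_real_Ioi_le (hα : 0 < α) (m r : ℕ) {t : ℝ} (ht : 1 ≤ t) :
    (pivotLaw α m r).real (Ioi t) ≤
      ((m + 1 + r : ℕ) : ℝ) ^ (r + 1) * t ^ (-(α * (r + 1))) := by
  have ht0 : 0 < t := one_pos.trans_le ht
  have hp : 0 < α * ((r : ℝ) + 1) := by positivity
  set C : ℝ := ((m + 1 + r : ℕ) : ℝ) ^ (r + 1) * α with hC
  have hint : IntegrableOn (fun y : ℝ => C * y ^ (-(α * (r + 1)) - 1)) (Ioi t) :=
    (integrableOn_Ioi_rpow_of_lt (by linarith) ht0).const_mul _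
  have hle : pivotLaw α m r (Ioi t) ≤
      ENNReal.ofReal (∫ y in Ioi t, C * y ^ (-(α * (r + 1)) - 1)) := by
    rw [pivotLaw, withDensity_apply _ measurableSet_Ioi,
      Measure.restrict_restrict measurableSet_Ioi, Ioi_inter_Ioi, sup_of_le_left ht,
      ofReal_integral_eq_lintegral_ofReal hint]
    · refine setLIntegral_mono' measurableSet_Ioi fun y hy => ENNReal.ofReal_le_ofReal ?_
      have hy1 : 1 < y := ht.trans_lt hy
      have hy0 : 0 < y := one_pos.trans hy1
      have hw := one_sub_rpow_neg_pos hα hy1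
      have hw1 : 1 - y ^ (-α) ≤ 1 := by
        have : 0 < y ^ (-α) := by positivity
        linarith
      rw [orderStatPDF_eq]
      calc _ ≤ ((m + 1 + r : ℕ) : ℝ) ^ (r + 1) * α * 1 * y ^ (-(α * (r + 1)) - 1) := by
            gcongr
            · exact factorial_div_le_pow m r
            · exact pow_le_one₀ hw.le hw1
        _ = _ := by rw [mul_one]
    · filter_upwards [ae_restrict_mem measurableSet_Ioi] with y hy
      have hy0 : 0 < y := ht0.trans hy
      simp only [Pi.zero_apply]
      positivity
  have hval : ∫ y in Ioi t, C * y ^ (-(α * (r + 1)) - 1) =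
      ((m + 1 + r : ℕ) : ℝ) ^ (r + 1) * t ^ (-(α * (r + 1))) / (r + 1) := by
    rw [integral_const_mul, integral_Ioi_rpow_of_lt (by linarith) ht0, sub_add_cancel, hC]
    field_simp
  have hnn : 0 ≤ ((m + 1 + r : ℕ) : ℝ) ^ (r + 1) * t ^ (-(α * (r + 1))) := by positivity
  rw [measureReal_def]
  refine ENNReal.toReal_le_of_le_ofReal hnn (hle.trans (ENNReal.ofReal_le_ofReal ?_))
  rw [hval]
  refine div_le_self hnn ?_
  have : (0 : ℝ) ≤ r := Nat.cast_nonneg r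
  linarith

/-- At most at `b` the pivot forces `m` further entries below `b`, whence the geometric factor,
which beats the polynomial one as `m` grows. -/
lemma pivotLaw_real_Iic_le (hα : 0 < α) (m r : ℕ) {b : ℝ} (hb : 1 < b) :
    (pivotLaw α m r).real (Iic b) ≤
      ((m + 1 + r : ℕ) : ℝ) ^ (r + 1) * α * (1 - b ^ (-α)) ^ m * (b - 1) := by
  have hwb := one_sub_rpow_neg_pos hα hb
  have hb1 : 0 < b - 1 := by linarith
  have hp : 0 < α * ((r : ℝ) + 1) := by positivity
  rw [measureReal_def]
  refine ENNReal.toReal_le_of_le_ofReal (by positivity) ?_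
  rw [pivotLaw, withDensity_apply _ measurableSet_Iic,
    Measure.restrict_restrict measurableSet_Iic, inter_comm, Ioi_inter_Iic]
  calc ∫⁻ y in Ioc 1 b, ENNReal.ofReal (orderStatPDF (m + 1 + r) (m + 1) α y)
      ≤ ∫⁻ _ in Ioc 1 b,
        ENNReal.ofReal (((m + 1 + r : ℕ) : ℝ) ^ (r + 1) * α * (1 - b ^ (-α)) ^ m) := by
        refine setLIntegral_mono' measurableSet_Ioc fun y hy => ENNReal.ofReal_le_ofReal ?_
        have hy0 : 0 < y := one_pos.trans hy.1
        have hw := one_sub_rpow_neg_pos hα hy.1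
        have h1 : b ^ (-α) ≤ y ^ (-α) :=
          Real.rpow_le_rpow_of_nonpos hy0 hy.2 (by linarith)
        have h2 : y ^ (-(α * ((r : ℝ) + 1)) - 1) ≤ 1 :=
          Real.rpow_le_one_of_one_le_of_nonpos hy.1.le (by linarith)
        rw [orderStatPDF_eq]
        calc _ ≤ ((m + 1 + r : ℕ) : ℝ) ^ (r + 1) * α * (1 - b ^ (-α)) ^ m * 1 := by
              gcongr
              exact factorial_div_le_pow m r
          _ = _ := mul_one _
    _ = _ := by
        rw [setLIntegral_const, Real.volume_Ioc, ← ENNReal.ofReal_mul (by positivity)]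

lemma tendsto_pivotLaw_real_Iic (hα : 0 < α) (r : ℕ) {b : ℝ} (hb : 1 < b) :
    Tendsto (fun m => (pivotLaw α m r).real (Iic b)) atTop (𝓝 0) := by
  set q := 1 - b ^ (-α) with hq
  have hq0 : 0 < q := one_sub_rpow_neg_pos hα hb
  have hq1 : q < 1 := by
    have : 0 < b ^ (-α) := by have : 0 < b := by linarith
                              positivity
    linarith
  have h := (tendsto_pow_const_mul_const_pow_of_abs_lt_one (r + 1)
    (by rwa [abs_of_pos hq0] : |q| < 1)).comp (tendsto_add_atTop_nat (1 + r))
  have h' := h.mul_const ((q ^ (1 + r))⁻¹ * α * (b - 1))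
  rw [zero_mul] at h'
  refine squeeze_zero (fun _ => measureReal_nonneg) (fun m => ?_) h'
  refine (pivotLaw_real_Iic_le hα m r hb).trans (le_of_eq ?_)
  simp only [Function.comp]
  rw [pow_add q, ← add_assoc m 1 r]
  have := pow_pos hq0 (1 + r)
  field_simp
  rw [← hq]
  ring

/-! ### Growth of the conditional variance -/

/-- The limit is the variance of the untruncated Pareto law, finite exactly for `α > 2`. -/
lemma tendsto_condVar_of_two_lt (hα : 2 < α) :
    Tendsto (condVar 1 0 α) atTop (𝓝 (α / ((α - 2) * (α - 1) ^ 2))) := by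
  have h1 : α ≠ 1 := by linarith
  have h2 : α ≠ 2 := hα.ne'
  have t0 : Tendsto (fun y : ℝ => y ^ (-α)) atTop (𝓝 0) := tendsto_rpow_neg_atTop (by linarith)
  have t1 : Tendsto (fun y : ℝ => y ^ (1 - α)) atTop (𝓝 0) := by
    simpa using tendsto_rpow_neg_atTop (y := α - 1) (by linarith)
  have t2 : Tendsto (fun y : ℝ => y ^ (2 - α)) atTop (𝓝 0) := by
    simpa using tendsto_rpow_neg_atTop (y := α - 2) (by linarith)
  have e : condVar 1 0 α = fun y => ((1 : ℕ) - (0 : ℕ) : ℝ) / (1 - y ^ (-α)) *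
      ((1 - y ^ (2 - α)) / (1 - 2 / α) -
        1 / (1 - 1 / α) ^ 2 * ((1 - y ^ (1 - α)) ^ 2 / (1 - y ^ (-α)))) := by
    ext y
    rw [condVar, if_neg h1, if_neg h2]
  have d0 : Tendsto (fun y : ℝ => 1 - y ^ (-α)) atTop (𝓝 (1 - 0)) := t0.const_sub 1
  have hlim := ((tendsto_const_nhds (x := ((1 : ℕ) - (0 : ℕ) : ℝ))).div d0 (by norm_num)).mul
    (((t2.const_sub 1).div_const (1 - 2 / α)).sub
      ((((t1.const_sub 1).pow 2).div d0 (by norm_num)).const_mul (1 / (1 - 1 / α) ^ 2)))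
  rw [e]
  convert hlim using 2
  have h3 : α - 1 ≠ 0 := by linarith
  have h4 : α - 2 ≠ 0 := by linarith
  have h5 : 0 < α := by linarith
  have e1 : 1 - 1 / α = (α - 1) / α := by field_simp
  have e2 : 1 - 2 / α = (α - 2) / α := by field_simp
  rw [e1, e2]
  norm_num
  field_simp
  ring

/-- At `α = 2` the truncated second moment diverges logarithmically while the mean stays bounded. -/
lemma tendsto_condVar_two : Tendsto (condVar 1 0 2) atTop atTop := by
  have hlog : Tendsto (fun y : ℝ => 2 * (Real.log y - 2)) atTop atTop :=
    (tendsto_atTop_add_const_right _ (-2) Real.tendsto_log_atTop).const_mul_atTop two_pos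
  refine tendsto_atTop_mono' _ ?_ hlog
  filter_upwards [eventually_gt_atTop (1 : ℝ), Real.tendsto_log_atTop.eventually_ge_atTop 2]
    with y hy hl
  rw [condVar, if_neg (by norm_num), if_pos rfl]
  have h1 : (1 : ℝ) ≤ y ^ 2 / (y ^ 2 - 1) := by
    rw [le_div_iff₀ (by nlinarith)]; linarith
  have h2 : (y - 1) / (y + 1) ≤ 1 := by
    rw [div_le_one (by linarith)]; linarith
  have h3 : Real.log y - 2 ≤ Real.log y - 2 * ((y - 1) / (y + 1)) := by linarith
  push_cast
  calc 2 * (Real.log y - 2) ≤ 2 * (Real.log y - 2 * ((y - 1) / (y + 1))) := by linarith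
    _ = 2 * 1 * (Real.log y - 2 * ((y - 1) / (y + 1))) := by ring
    _ ≤ 2 * (1 - 0) * (y ^ 2 / (y ^ 2 - 1)) * (Real.log y - 2 * ((y - 1) / (y + 1))) := by
        gcongr
        · linarith
        · linarith

/-- The pivot is negligible compared to the conditional standard deviation of the trimmed sum, with
high probability: the parameters are chosen so that the tail bound of the pivot at
`δ √(m M)` is small. -/
def PivotNegligible (α : ℝ) (r : ℕ) : Prop :=
  ∀ ε > 0, ∀ δ > 0, ∃ M > 0, ∃ b > 1, (∀ y ≥ b, M ≤ condVar 1 0 α y) ∧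
    ∀ᶠ m : ℕ in atTop, (2 * (m : ℝ)) ^ (r + 1) * (δ ^ 2 * (m * M)) ^ (-(α * (r + 1)) / 2) ≤ ε

/-- With `M` half the limiting variance, the bound is a constant times `m ^ ((r + 1) (1 - α / 2))`,
a negative power of `m`. -/
lemma pivotNegligible_of_two_lt (hα : 2 < α) (r : ℕ) : PivotNegligible α r := by
  intro ε hε δ hδ
  set c := α / ((α - 2) * (α - 1) ^ 2) with hc
  have hc0 : 0 < c := by
    have h1 : 0 < α - 2 := by linarith
    have h2 : 0 < α - 1 := by linarith
    have h3 : 0 < α := by linarith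
    positivity
  obtain ⟨b, hb⟩ := eventually_atTop.1
    ((tendsto_condVar_of_two_lt hα).eventually (lt_mem_nhds (half_lt_self hc0)))
  refine ⟨c / 2, half_pos hc0, max b 2, lt_max_of_lt_right (by norm_num),
    fun y hy => (hb y ((le_max_left _ _).trans hy)).le, ?_⟩
  have hneg : 0 < (α * (r + 1)) / 2 - (r + 1 : ℝ) := by
    have : (0 : ℝ) < r + 1 := by positivity
    nlinarith
  have hlim : Tendsto (fun m : ℕ => 2 ^ (r + 1) * (δ ^ 2 * (c / 2)) ^ (-(α * (r + 1)) / 2) *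
      (m : ℝ) ^ (-((α * (r + 1)) / 2 - (r + 1 : ℝ)))) atTop (𝓝 0) := by
    have := ((tendsto_rpow_neg_atTop hneg).comp tendsto_natCast_atTop_atTop).const_mul
      (2 ^ (r + 1) * (δ ^ 2 * (c / 2)) ^ (-(α * (r + 1)) / 2))
    simpa only [mul_zero, Function.comp_def] using this
  filter_upwards [hlim.eventually (gt_mem_nhds hε), eventually_gt_atTop 0] with m hm hm0
  refine le_trans (le_of_eq ?_) hm.le
  have hm0' : (0 : ℝ) < m := by exact_mod_cast hm0
  rw [show δ ^ 2 * (m * (c / 2)) = (δ ^ 2 * (c / 2)) * m by ring,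
    Real.mul_rpow (by positivity) hm0'.le, mul_pow,
    show -((α * (r + 1)) / 2 - (r + 1 : ℝ)) = ((r + 1 : ℕ) : ℝ) + -(α * (r + 1)) / 2 by
      push_cast; ring, Real.rpow_add hm0', Real.rpow_natCast]
  ring

/-- Here the powers of `m` cancel and the bound is the constant `4 / (δ ^ 2 * M) ^ 2`. It is small
for large `M`, and any `M` is allowed because the conditional variance is unbounded. -/
lemma pivotNegligible_two : PivotNegligible 2 1 := by
  intro ε hε δ hδ
  obtain ⟨M, hM0, hM⟩ : ∃ M : ℝ, 0 < M ∧ 4 / (δ ^ 2 * M) ^ 2 ≤ ε := by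
    refine ⟨2 / (δ ^ 2 * √ε), by positivity, le_of_eq ?_⟩
    have := Real.sq_sqrt hε.le
    field_simp
    rw [this]
    norm_num
  obtain ⟨b, hb⟩ := eventually_atTop.1 (tendsto_condVar_two.eventually_ge_atTop M)
  refine ⟨M, hM0, max b 2, lt_max_of_lt_right (by norm_num),
    fun y hy => hb y ((le_max_left _ _).trans hy), ?_⟩
  filter_upwards [eventually_gt_atTop 0] with m hm0
  have hm0' : (0 : ℝ) < m := by exact_mod_cast hm0
  refine le_trans (le_of_eq ?_) hM
  have e : -((2 : ℝ) * ((1 : ℕ) + 1)) / 2 = -((2 : ℕ) : ℝ) := by norm_num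
  rw [e, Real.rpow_neg (by positivity), Real.rpow_natCast]
  field_simp
  push_cast
  ring

theorem tendsto_integral_kolmogorovDist (hα : 0 < α) {r : ℕ} (h : PivotNegligible α r) :
    Tendsto (fun m => ∫ y, kolmogorovDist (lowerKernel hα m y)
      (condNormal (m + 1 + r) (r + 1) α y) ∂(pivotLaw α m r)) atTop (𝓝 0) := by
  rw [Metric.tendsto_atTop']
  intro ε hε
  have hε4 : 0 < ε / 4 := by positivity
  obtain ⟨δ, hδ, hkd⟩ := exists_kolmogorovDist_lowerKernel_le hα hε4
  obtain ⟨M, hM, b, hb, hvar, htail⟩ := h (ε / 4) hε4 δ hδ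
  have hlow := (tendsto_pivotLaw_real_Iic hα r hb).eventually (gt_mem_nhds hε4)
  have ht1 : ∀ᶠ m : ℕ in atTop, 1 ≤ δ * √(m * M) :=
    ((Real.tendsto_sqrt_atTop.comp
      (tendsto_natCast_atTop_atTop.atTop_mul_const hM)).const_mul_atTop hδ).eventually_ge_atTop 1
  obtain ⟨K, hK⟩ := eventually_atTop.1 (hlow.and (ht1.and (htail.and (eventually_ge_atTop (r + 1)))))
  refine ⟨K, fun m hm => ?_⟩
  obtain ⟨hl, ht, htl, hmr⟩ := hK m hm.le
  have := isProbabilityMeasure_pivotLaw hα m r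
  -- Pivots up to `b` and pivots above `t` each have probability at most `ε / 4`, and the distance
  -- is at most one. In between, `M ≤ condVar 1 0 α y` gives `y ≤ t ≤ δ * √(m * condVar 1 0 α y)`,
  -- so the uniform central limit theorem bounds the distance by `ε / 4`.
  set t := δ * √(m * M) with htdef
  have hti : (pivotLaw α m r).real (Ioi t) ≤ ε / 4 := by
    refine (pivotLaw_real_Ioi_le hα m r ht).trans (le_trans ?_ htl)
    have ht2 : t ^ 2 = δ ^ 2 * (m * M) := by
      rw [htdef, mul_pow, Real.sq_sqrt (by positivity)]
    have e : t ^ (-(α * (r + 1))) = (δ ^ 2 * (m * M)) ^ (-(α * (r + 1)) / 2) := by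
      rw [← ht2, ← Real.rpow_natCast, ← Real.rpow_mul (by positivity)]
      congr 1
      push_cast
      ring
    rw [e]
    -- What remains is `m + 1 + r ≤ 2 * m`, which holds since `r + 1 ≤ m`.
    gcongr
    push_cast
    have : ((r + 1 : ℕ) : ℝ) ≤ m := by exact_mod_cast hmr
    push_cast at this
    linarith
  rw [Real.dist_eq, sub_zero, abs_of_nonneg (integral_nonneg fun y => kolmogorovDist_nonneg _ _)]
  have hi1 : Integrable ((Iic b).indicator (1 : ℝ → ℝ)) (pivotLaw α m r) :=
    (integrable_const (1 : ℝ)).indicator measurableSet_Iic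
  have hi2 : Integrable ((Ioi t).indicator (1 : ℝ → ℝ)) (pivotLaw α m r) :=
    (integrable_const (1 : ℝ)).indicator measurableSet_Ioi
  have hle : ∫ y, kolmogorovDist (lowerKernel hα m y) (condNormal (m + 1 + r) (r + 1) α y)
        ∂(pivotLaw α m r) ≤
      ∫ y, (ε / 4 + (Iic b).indicator (1 : ℝ → ℝ) y + (Ioi t).indicator (1 : ℝ → ℝ) y)
        ∂(pivotLaw α m r) := by
    refine integral_mono_of_nonneg (ae_of_all _ fun y => kolmogorovDist_nonneg _ _)
      (((integrable_const _).add hi1).add hi2) (ae_of_all _ fun y => ?_)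
    have h01 : 0 ≤ (Iic b).indicator (1 : ℝ → ℝ) y := indicator_nonneg (fun _ _ => zero_le_one) _
    have h02 : 0 ≤ (Ioi t).indicator (1 : ℝ → ℝ) y := indicator_nonneg (fun _ _ => zero_le_one) _
    have hk1 := kolmogorovDist_le_one (lowerKernel hα m y) (condNormal (m + 1 + r) (r + 1) α y)
    simp only
    by_cases hyb : y ≤ b
    · rw [indicator_of_mem (mem_Iic.2 hyb), Pi.one_apply]; linarith
    · by_cases hyt : t < y
      · rw [indicator_of_mem (mem_Ioi.2 hyt), Pi.one_apply]; linarith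
      · have hy : b < y := not_le.1 hyb
        have := hkd m r y (hb.trans hy) ((not_lt.1 hyt).trans (by
          rw [htdef]
          gcongr
          exact hvar y hy.le))
        linarith
  have hval : ∫ y, (ε / 4 + (Iic b).indicator (1 : ℝ → ℝ) y + (Ioi t).indicator (1 : ℝ → ℝ) y)
        ∂(pivotLaw α m r) =
      ε / 4 + (pivotLaw α m r).real (Iic b) + (pivotLaw α m r).real (Ioi t) := by
    have hi0 : Integrable (fun y => ε / 4 + (Iic b).indicator (1 : ℝ → ℝ) y) (pivotLaw α m r) :=
      (integrable_const _).add hi1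
    rw [integral_add hi0 hi2, integral_add (integrable_const _) hi1,
      integral_indicator_one measurableSet_Iic, integral_indicator_one measurableSet_Ioi]
    simp
  rw [hval] at hle
  linarith

/-- For `α > 2` every `r` will do. At `α = 2` the threshold is `2`, hence `r = 1`. -/
lemma pivotNegligible_threshold (hα : 2 ≤ α) (hα4 : α ≤ 4) {r : ℕ} (hr : r + 1 = threshold α) :
    PivotNegligible α r := by
  rcases hα.lt_or_eq with h | h
  · exact pivotNegligible_of_two_lt h r
  · subst h
    have h1 : (1 : ℕ) = r := by
      have : threshold 2 = 2 := by
        rw [threshold, show (4 : ℝ) / 2 - 1 = 1 by norm_num, Nat.floor_one]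
      omega
    rw [← h1]
    exact pivotNegligible_two

end Tails

/-! ### The conditional laws and the error bound for an iid Pareto sample -/

section Sample

lemma aemeasurable_sample {α : ℝ} {Ω : Type*} [MeasurableSpace Ω] {P : Measure Ω}
    {n : ℕ} {X : Ω → Fin n → ℝ}
    (hlaw : ∀ i, HasLaw (fun ω => X ω i) (paretoMeasure 1 α) P) : AEMeasurable X P :=
  aemeasurable_pi_iff.2 fun i => (hlaw i).aemeasurable

variable {α : ℝ} {Ω : Type*} [MeasurableSpace Ω] {P : Measure Ω} [IsProbabilityMeasure P]

lemma map_sample {n : ℕ} {X : Ω → Fin n → ℝ}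
    (hind : iIndepFun (fun (i : Fin n) (ω : Ω) => X ω i) P)
    (hlaw : ∀ i, HasLaw (fun ω => X ω i) (paretoMeasure 1 α) P) :
    P.map X = Measure.pi fun _ => paretoMeasure 1 α := by
  have h := (iIndepFun_iff_map_fun_eq_pi_map fun i => (hlaw i).aemeasurable).1 hind
  simpa only [(hlaw _).map_eq] using h

lemma condDistrib_trimmedSum_and_sum (hα : 0 < α) {n r : ℕ} (hn : r + 1 < n) {X : Ω → Fin n → ℝ}
    (hX : AEMeasurable X P) (hlaw : P.map X = Measure.pi fun _ => paretoMeasure 1 α) :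
    ∀ᵐ y ∂(volume.restrict (Ioi (1 : ℝ))),
      condDistrib (fun ω => trimmedSum (X ω) (r + 1)) (fun ω => pivot (X ω) (r + 1)) P y =
        lowerKernel hα (n - 1 - r) y ∧
      ∀ x, cdf (condDistrib (fun ω => ∑ i, X ω i) (fun ω => pivot (X ω) (r + 1)) P y) x =
        (lowerKernel hα (n - 1 - r) y ∗ upperKernel hα r y).real (Iic (x - y)) := by
  obtain ⟨m, rfl⟩ : ∃ m, n = m + 1 + r := ⟨n - 1 - r, by omega⟩
  have hm : 0 < m := by omega
  rw [show m + 1 + r - 1 - r = m by omega]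
  filter_upwards [condDistrib_trimmedSum hα hX hlaw, condDistrib_sum hα hm hX hlaw] with y h1 h2
  exact ⟨h1, h2⟩

lemma lowerKernel_moments (hα : 0 < α) {m : ℕ} (hm : 0 < m) (r : ℕ) {y : ℝ} (hy : 1 < y) :
    MemLp id 2 (lowerKernel hα m y) ∧
      ∫ t, t ∂(lowerKernel hα m y) = condMean (m + 1 + r) (r + 1) α y ∧
      variance id (lowerKernel hα m y) = condVar (m + 1 + r) (r + 1) α y ∧
      0 < condVar (m + 1 + r) (r + 1) α y := by
  have := isProbabilityMeasure_below hα hy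
  have h2 := memLp_below hα hy
  have hc : (((m + 1 + r : ℕ) : ℝ) - (r + 1 : ℕ)) = m := by push_cast; ring
  rw [lowerKernel_apply, lowerLaw_of_one_lt hy]
  refine ⟨memLp_sumLaw h2, ?_, ?_, condVar_pos hα hm hy⟩
  · rw [integral_sumLaw h2, integral_id_below hα hy,
      condMean_eq_mul (m + 1 + r), hc]
  · rw [variance_sumLaw h2, variance_below hα hy, condVar_eq_mul (m + 1 + r), hc]

lemma upperKernel_succ (hα : 0 < α) (N : ℕ) {y : ℝ} (hy : 1 < y) :
    upperKernel hα (N + 1) y =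
      volume.withDensity fun u => ENNReal.ofReal (convPow (upperPDF α y) (N + 1) u) := by
  rw [upperKernel_apply, upperLaw_of_one_lt hy]
  exact (convPow_upperPDF_spec hα (one_pos.trans hy) N).2.2

lemma sample_finite (hα : 0 < α) {r m : ℕ} (hm : 0 < m) {X : Ω → Fin (m + 1 + r) → ℝ}
    (hX : AEMeasurable X P) (hlaw : P.map X = Measure.pi fun _ => paretoMeasure 1 α) :
    (∀ᵐ y ∂(volume.restrict (Ioi (1 : ℝ))),
      condDistrib (fun ω => (trimmedSum (X ω) (r + 1), topSum (X ω) (r + 1)))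
          (fun ω => pivot (X ω) (r + 1)) P y =
        (condDistrib (fun ω => trimmedSum (X ω) (r + 1)) (fun ω => pivot (X ω) (r + 1)) P y).prod
        (condDistrib (fun ω => topSum (X ω) (r + 1)) (fun ω => pivot (X ω) (r + 1)) P y)) ∧
    (2 ≤ r + 1 → ∀ᵐ y ∂(volume.restrict (Ioi (1 : ℝ))),
      condDistrib (fun ω => topSum (X ω) (r + 1)) (fun ω => pivot (X ω) (r + 1)) P y =
        volume.withDensity
          (fun u => ENNReal.ofReal (convPow (upperPDF α y) (r + 1 - 1) u))) ∧
    (∀ᵐ y ∂(volume.restrict (Ioi (1 : ℝ))),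
      MemLp id 2
        (condDistrib (fun ω => trimmedSum (X ω) (r + 1)) (fun ω => pivot (X ω) (r + 1)) P y) ∧
      ∫ t, t ∂(condDistrib (fun ω => trimmedSum (X ω) (r + 1))
        (fun ω => pivot (X ω) (r + 1)) P y) = condMean (m + 1 + r) (r + 1) α y ∧
      variance id (condDistrib (fun ω => trimmedSum (X ω) (r + 1))
        (fun ω => pivot (X ω) (r + 1)) P y) = condVar (m + 1 + r) (r + 1) α y ∧
      0 < condVar (m + 1 + r) (r + 1) α y) ∧
    (∀ x : ℝ, 1 ≤ x →
      |cdf (P.map (fun ω => ∑ i, X ω i)) x - normexCDF (m + 1 + r) (r + 1) α x| ≤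
        2 * ∫ y in (1 : ℝ)..x, orderStatPDF (m + 1 + r) (m + 1) α y *
          kolmogorovDist
            (condDistrib (fun ω => trimmedSum (X ω) (r + 1)) (fun ω => pivot (X ω) (r + 1)) P y)
            (condNormal (m + 1 + r) (r + 1) α y)) := by
  have hL := condDistrib_trimmedSum hα hX hlaw
  have hU := condDistrib_topSum hα hX hlaw
  have hI : ∀ᵐ y ∂(volume.restrict (Ioi (1 : ℝ))), 1 < y := ae_restrict_mem measurableSet_Ioi
  refine ⟨?_, fun hr => ?_, ?_, fun x hx => ?_⟩
  · filter_upwards [condDistrib_trimmedSum_topSum hα hX hlaw, hL, hU] with y h1 h2 h3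
    rw [h1, h2, h3]
  · obtain ⟨N, rfl⟩ : ∃ N, r = N + 1 := ⟨r - 1, by omega⟩
    filter_upwards [hU, hI] with y h1 hy
    rw [h1, upperKernel_succ hα N hy, Nat.add_sub_cancel]
  · filter_upwards [hL, hI] with y h1 hy
    rw [h1]
    exact lowerKernel_moments hα hm r hy
  · refine (abs_cdf_sub_normexCDF_le hα hm hX hlaw hx).trans (le_of_eq ?_)
    congr 1
    refine intervalIntegral.integral_congr_ae ?_
    filter_upwards [(ae_restrict_iff' measurableSet_Ioi).1 hL] with y h1 hy
    rw [uIoc_of_le hx] at hy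
    rw [h1 hy.1]

end Sample

end Normex

end

theorem theorem1 {α : ℝ} (hα : 0 < α) (hα4 : α ≤ 4) {k : ℕ} (hk : k = Normex.threshold α)
    {Ω : ℕ → Type*} [∀ n, MeasurableSpace (Ω n)]
    (P : ∀ n, Measure (Ω n)) [∀ n, IsProbabilityMeasure (P n)]
    (X : ∀ n, Ω n → Fin n → ℝ)
    (hind : ∀ n, iIndepFun (fun (i : Fin n) (ω : Ω n) => X n ω i) (P n))
    (hlaw : ∀ (n : ℕ) (i : Fin n), HasLaw (fun ω => X n ω i) (paretoMeasure 1 α) (P n)) :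
    -- for every sample size: the decomposition, the exact parts of the mixture, the conditional
    -- mean and variance of the trimmed sum, and the error bound
    (∀ n, k < n →
      (∀ ω, ∑ i, X n ω i =
        Normex.trimmedSum (X n ω) k + Normex.pivot (X n ω) k + Normex.topSum (X n ω) k) ∧
      (P n).map (fun ω => Normex.pivot (X n ω) k) =
        (volume.restrict (Ioi 1)).withDensity
          (fun y => ENNReal.ofReal (Normex.orderStatPDF n (n - k + 1) α y)) ∧
      (∀ᵐ y ∂(volume.restrict (Ioi (1 : ℝ))),
        condDistrib (fun ω => (Normex.trimmedSum (X n ω) k, Normex.topSum (X n ω) k))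
            (fun ω => Normex.pivot (X n ω) k) (P n) y =
          (condDistrib (fun ω => Normex.trimmedSum (X n ω) k)
            (fun ω => Normex.pivot (X n ω) k) (P n) y).prod
          (condDistrib (fun ω => Normex.topSum (X n ω) k)
            (fun ω => Normex.pivot (X n ω) k) (P n) y)) ∧
      (2 ≤ k → ∀ᵐ y ∂(volume.restrict (Ioi (1 : ℝ))),
        condDistrib (fun ω => Normex.topSum (X n ω) k)
            (fun ω => Normex.pivot (X n ω) k) (P n) y =
          volume.withDensity
            (fun u => ENNReal.ofReal (Normex.convPow (Normex.upperPDF α y) (k - 1) u))) ∧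
      (∀ᵐ y ∂(volume.restrict (Ioi (1 : ℝ))),
        MemLp id 2 (condDistrib (fun ω => Normex.trimmedSum (X n ω) k)
          (fun ω => Normex.pivot (X n ω) k) (P n) y) ∧
        ∫ t, t ∂(condDistrib (fun ω => Normex.trimmedSum (X n ω) k)
          (fun ω => Normex.pivot (X n ω) k) (P n) y) = Normex.condMean n k α y ∧
        variance id (condDistrib (fun ω => Normex.trimmedSum (X n ω) k)
          (fun ω => Normex.pivot (X n ω) k) (P n) y) = Normex.condVar n k α y ∧
        0 < Normex.condVar n k α y) ∧
      (∀ x : ℝ, 1 ≤ x →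
        |cdf ((P n).map (fun ω => ∑ i, X n ω i)) x - Normex.normexCDF n k α x| ≤
          2 * ∫ y in (1 : ℝ)..x, Normex.orderStatPDF n (n - k + 1) α y *
            Normex.kolmogorovDist
              (condDistrib (fun ω => Normex.trimmedSum (X n ω) k)
                (fun ω => Normex.pivot (X n ω) k) (P n) y)
              (Normex.condNormal n k α y))) ∧
    -- the normal approximation of the trimmed sum given the pivot
    (∀ᵐ y ∂(volume.restrict (Ioi (1 : ℝ))),
      Tendsto (fun n => Normex.kolmogorovDist
          (condDistrib (fun ω => Normex.trimmedSum (X n ω) k)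
            (fun ω => Normex.pivot (X n ω) k) (P n) y)
          (Normex.condNormal n k α y)) atTop (𝓝 0)) ∧
    -- the approximation of the whole sum given the pivot
    (∀ᵐ y ∂(volume.restrict (Ioi (1 : ℝ))),
      TendstoUniformlyOn
        (fun n x => cdf (condDistrib (fun ω => ∑ i, X n ω i)
            (fun ω => Normex.pivot (X n ω) k) (P n) y) x - Normex.normexInner n k α y (x - y))
        (fun _ => 0) atTop (Ici y)) ∧
    -- the approximation of the cdf of the sum
    (2 ≤ α →
      TendstoUniformlyOn
        (fun n x => cdf ((P n).map (fun ω => ∑ i, X n ω i)) x - Normex.normexCDF n k α x)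
        (fun _ => 0) atTop (Ici 1)) := by
  obtain ⟨r, rfl⟩ : ∃ r, k = r + 1 := ⟨_, hk⟩
  have hX := fun n => Normex.aemeasurable_sample (hlaw n)
  have hmap := fun n => Normex.map_sample (hind n) (hlaw n)
  have hshift : Tendsto (fun n => n - 1 - r) atTop atTop :=
    (tendsto_sub_atTop_nat r).comp (tendsto_sub_atTop_nat 1)
  have hsize : ∀ᶠ n : ℕ in atTop, r + 1 < n := eventually_gt_atTop (r + 1)
  have hn_eq : ∀ n : ℕ, r + 1 < n → n - 1 - r + 1 + r = n := fun n hn => by omega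
  -- The exceptional sets of all sample sizes are collected into one null set, so that limits in `n`
  -- can be taken at a fixed `y`.
  have hcond : ∀ᵐ y ∂(volume.restrict (Ioi (1 : ℝ))), ∀ n, r + 1 < n →
      condDistrib (fun ω => Normex.trimmedSum (X n ω) (r + 1))
          (fun ω => Normex.pivot (X n ω) (r + 1)) (P n) y =
        Normex.lowerKernel hα (n - 1 - r) y ∧
      ∀ x, cdf (condDistrib (fun ω => ∑ i, X n ω i)
          (fun ω => Normex.pivot (X n ω) (r + 1)) (P n) y) x =
        (Normex.lowerKernel hα (n - 1 - r) y ∗ Normex.upperKernel hα r y).real (Iic (x - y)) := by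
    rw [ae_all_iff]
    intro n
    by_cases hn : r + 1 < n
    · filter_upwards [Normex.condDistrib_trimmedSum_and_sum hα hn (hX n) (hmap n)] with y hy _
      exact hy
    · exact ae_of_all _ fun y h => absurd h hn
  have hI : ∀ᵐ y ∂(volume.restrict (Ioi (1 : ℝ))), 1 < y := ae_restrict_mem measurableSet_Ioi
  refine ⟨fun n hn => ?_, ?_, ?_, fun h2 => ?_⟩
  · obtain ⟨m, rfl⟩ : ∃ m, n = m + 1 + r := ⟨n - 1 - r, by omega⟩
    have hm : 0 < m := by omega
    rw [show m + 1 + r - (r + 1) + 1 = m + 1 by omega]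
    exact ⟨fun ω => Normex.sum_eq_trimmedSum_add r.succ_pos hn _,
      Normex.map_pivot_sample hα (hX _) (hmap _), Normex.sample_finite hα hm (hX _) (hmap _)⟩
  · filter_upwards [hcond, hI] with y hy h1
    refine ((Normex.tendsto_kolmogorovDist_lowerKernel hα r h1).comp hshift).congr' ?_
    filter_upwards [hsize] with n hn
    rw [(hy n hn).1, Function.comp_apply, hn_eq n hn]
  · filter_upwards [hcond, hI] with y hy h1
    rw [Metric.tendstoUniformlyOn_iff]
    intro ε hε
    have hlim := ((Normex.tendsto_kolmogorovDist_lowerKernel hα r h1).comp hshift).const_mul 2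
    rw [mul_zero] at hlim
    filter_upwards [hsize, hlim.eventually (gt_mem_nhds hε)] with n hn hlt x hx
    rw [Function.comp_apply, hn_eq n hn] at hlt
    have hb := Normex.abs_conv_sub_normexInner_le hα (m := n - 1 - r) (r := r) (by omega) h1 hx
    rw [hn_eq n hn] at hb
    rw [dist_comm, Real.dist_eq, sub_zero, (hy n hn).2]
    exact hb.trans_lt hlt
  · rw [Metric.tendstoUniformlyOn_iff]
    intro ε hε
    have hlim := ((Normex.tendsto_integral_kolmogorovDist hα
      (Normex.pivotNegligible_threshold h2 hα4 hk)).comp hshift).const_mul 2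
    rw [mul_zero] at hlim
    filter_upwards [hsize, hlim.eventually (gt_mem_nhds hε)] with n hn hlt x hx
    obtain ⟨m, rfl⟩ : ∃ m, n = m + 1 + r := ⟨n - 1 - r, by omega⟩
    rw [Function.comp_apply, show m + 1 + r - 1 - r = m by omega] at hlt
    rw [dist_comm, Real.dist_eq, sub_zero]
    refine lt_of_le_of_lt ?_ hlt
    refine (Normex.abs_cdf_sub_normexCDF_le hα (by omega) (hX _) (hmap _) hx).trans ?_
    exact mul_le_mul_of_nonneg_left (Normex.intervalIntegral_le_integral_pivotLaw hα hx) two_pos.le
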